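/- Let $n\ge 1$, let $\alpha>1$, $k>0$ and $p,q$ be real numbers, and write $\hat p_t(x)=(4\pi t)^{-n/2}e^{-|x|^2/(4t)}$ and $e^{t\Delta}U=\hat p_t*U$. For $T>0$ let $X_T=L^q_w((0,T),L^p(\mathbb{R}^n))$ with $w(t)=t^k$, i.e. the measurable $F$ on $\mathbb{R}^n\times(0,T)$ with $\int_0^T\|F(\cdot,t)\|_{L^p}^q\,t^k\,dt<\infty$. A weight is a measurable $v:\mathbb{R}^n\to(0,\infty)$ such that $v\,dx$ is a Radon measure; $L^p_v$ is the space of measurable $f$ with $\int|f|^pv\,dx<\infty$; and $v\in D_p$ means that $v$ is a weight and there are $t_0>0$ and $x\in\mathbb{R}^n$ with $v^{-1/p}\,\hat p_{t_0}(x-\cdot)\in L^{p'}(\mathbb{R}^n)$, $\frac1p+\frac1{p'}=1$. Let $U:\mathbb{R}^n\to\mathbb{R}$. A mild solution on $\mathbb{R}^n\times(0,T)$ of $\partial_tu-\Delta u=|u|^{\alpha-1}u$, $u(\cdot,0)=U$, is a function $u$ such that, for almost every $x$ and every $t\in(0,T)$, $$u(x,t)=\hat p_t*U(x)+\int_0^t\int_{\mathbb{R}^n}\hat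 p_{t-s}(x-y)\,|u(y,s)|^{\alpha-1}u(y,s)\,dy\,ds ,$$ both integrals being absolutely convergent. Theorem. Assume $$\min\{p,q\}>\alpha,\qquad \frac{k\alpha}{q-\alpha}<1,\qquad \beta:=\frac n2\Big(\frac{\alpha-1}{p}\Big)\Big(\frac{q}{q-\alpha}\Big)<1,$$ $$k+(q-\alpha)\Big(1-\beta-\frac{k\alpha}{q-\alpha}\Big)>-1,\qquad k<q-1 .$$ Suppose that $(x,t)\mapsto e^{t\Delta}U(x)$ belongs to $X_{T_0}$ for some $T_0>0$, and that $U\in L^p_{\tilde v}(\mathbb{R}^n)$ for some $\tilde v\in D_p$. Then there are $T\in(0,T_0]$ and a mild solution $u\in X_T$ on $\mathbb{R}^n\times(0,T)$. Moreover, for every $T>0$, every mild solution $u\in X_T$ on $\mathbb{R}^n\times(0,T)$ satisfies $\lim_{t\to0^+}u(x,t)=U(x)$ for almost every $x\in\mathbb{R}^n$. -/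

import Mathlib

open MeasureTheory Set Filter Topology

noncomputable section

/-- Euclidean space `ℝⁿ`. -/
abbrev Rn (n : ℕ) : Type := EuclideanSpace ℝ (Fin n)

/-- The Gauss–Weierstrass kernel `(4πt)^{-n/2} exp(-|x|²/(4t))`, used for `t > 0`. -/
def heatKernel (n : ℕ) (t : ℝ) (x : Rn n) : ℝ :=
  (4 * Real.pi * t) ^ (-(n : ℝ) / 2) * Real.exp (-‖x‖ ^ 2 / (4 * t))

/-- `(e^{tΔ} U)(x)`, the convolution of the heat kernel at time `t` with `U`. -/
def heatExtension {n : ℕ} (U : Rn n → ℝ) (x : Rn n) (t : ℝ) : ℝ :=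
  ∫ y, heatKernel n t (x - y) * U y

/-- A weight: a strictly positive measurable function `v` such that `v dx` is a Radon measure. -/
structure IsWeight {n : ℕ} (v : Rn n → ℝ) : Prop where
  measurable : Measurable v
  pos : ∀ x, 0 < v x
  locallyIntegrable : LocallyIntegrable v volume

/-- The class `D_p`, for `1 ≤ p < ∞`: weights `v` for which `v^{-1/p} p_{t₀}(x - ·)` lies in
`L^{p'}` for some time `t₀ > 0` and some point `x`, where `1/p + 1/p' = 1`. -/
def WeightClassD {n : ℕ} (p : ℝ) (v : Rn n → ℝ) : Prop :=
  IsWeight v ∧ ∃ t₀ : ℝ, 0 < t₀ ∧ ∃ x : Rn n,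
    MemLp (fun y => v y ^ (-1 / p) * heatKernel n t₀ (x - y))
      (ENNReal.conjExponent (ENNReal.ofReal p)) volume

/-- `U ∈ L^p_v(ℝⁿ)`, i.e. `∫ |U|^p v dx < ∞`. -/
def MemWeightedLp {n : ℕ} (p : ℝ) (v U : Rn n → ℝ) : Prop :=
  MemLp U (ENNReal.ofReal p) (volume.withDensity fun x => ENNReal.ofReal (v x))

/-- `F ∈ X_T = L^q_w((0,T), L^p(ℝⁿ))` with `w(t) = t^k`, i.e. `F` is measurable on
`ℝⁿ × (0,T)` and `∫₀ᵀ ‖F(·,t)‖_{L^p}^q t^k dt < ∞`. -/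
def MemX {n : ℕ} (p q k T : ℝ) (F : Rn n → ℝ → ℝ) : Prop :=
  AEStronglyMeasurable (fun z : Rn n × ℝ => F z.1 z.2)
      ((volume : Measure (Rn n)).prod (volume.restrict (Ioo 0 T))) ∧
    ∫⁻ t in Ioo 0 T, eLpNorm (fun x => F x t) (ENNReal.ofReal p) volume ^ q *
      ENNReal.ofReal (t ^ k) < ⊤

/-- The power nonlinearity `N(r) = |r|^{α-1} r`. -/
def powerNL (α r : ℝ) : ℝ := |r| ^ (α - 1) * r

/-- `u` is a mild solution on `ℝⁿ × (0,T)` of `∂ₜu - Δu = |u|^{α-1}u`, `u(·,0) = U`: for almost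
every `x` and every `t ∈ (0,T)` the two integrals in the Duhamel formula converge absolutely
and the formula holds at `(x,t)`. -/
def IsMildSolution {n : ℕ} (α T : ℝ) (U : Rn n → ℝ) (u : Rn n → ℝ → ℝ) : Prop :=
  ∀ᵐ x : Rn n, ∀ t ∈ Ioo 0 T,
    Integrable (fun y => heatKernel n t (x - y) * U y) volume ∧
    Integrable (fun z : ℝ × Rn n => heatKernel n (t - z.1) (x - z.2) * powerNL α (u z.2 z.1))
      ((volume.restrict (Ioo 0 t)).prod volume) ∧
    u x t = heatExtension U x t +
      ∫ s in Ioo 0 t, ∫ y, heatKernel n (t - s) (x - y) * powerNL α (u y s)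

end

open scoped ENNReal

/-! Write `D f` for the Duhamel integral of `f`, `h` for the heat extension of `U`, and `N` for the
nonlinearity.

Norm estimate (`mixedNormPow_heatDuhamel_le`): the heat semigroup maps `L^{p/α}` to `L^p` with norm
at most `τ^{-γ}`, `γ = (n/2)(α-1)/p`. Minkowski's inequality in `x` and Hölder's in time against
`s^k` bound the `q`-th power of the norm of `D(F^α)` by `K T^e` times the `α`-th power of that of
`F`. The exponent hypotheses make the time integrals converge and give `e > 0`, so the nonlinear
term is small on short intervals.

Existence uses monotonicity instead of contraction. `exists_majorant` iterates upwards from `0` to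
solve `w = |h| + D(w^α)`. In `exists_signed_solution` the unknown is `z = u + w`, which solves `z =
(h + |h|) + D(N(z - w) + w^α)`; its data and nonlinearity are nonnegative and increasing, and `2w`
is a supersolution, so iteration from `0` converges to some `z ≤ 2w` and `|u| ≤ w`. The limit
equations hold pointwise in `[0,∞]`, so only finiteness is an almost-everywhere matter.

Pointwise control (`ae_heatDuhamel_lt_top_and_tendsto`): `D f(x,t)` is at most a constant times the
integral over `s < t` of the heat maximal function of `f(·,s)` at `x`. Weak-type and Kolmogorov
estimates make this finite for almost every `x`, for all `t` at once, and it vanishes as `t → 0`.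
Together with convergence of the heat extension at Lebesgue points (`ae_tendsto_heatExtension`),
this yields the initial trace of every mild solution in the space. -/

/-! ### The heat kernel: total mass, level sets, comparison of times. -/

lemma heatKernel_nonneg (n : ℕ) {t : ℝ} (ht : 0 ≤ t) (x : Rn n) : 0 ≤ heatKernel n t x := by
  unfold heatKernel
  positivity

lemma measurable_heatKernel (n : ℕ) :
    Measurable (fun z : ℝ × Rn n => heatKernel n z.1 z.2) := by
  unfold heatKernel
  fun_prop

/-- The heat kernel with values in `[0, ∞]`. -/
noncomputable def heatKernelENN (n : ℕ) (t : ℝ) (x : Rn n) : ℝ≥0∞ :=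
  ENNReal.ofReal (heatKernel n t x)

lemma measurable_heatKernelENN (n : ℕ) :
    Measurable (fun z : ℝ × Rn n => heatKernelENN n z.1 z.2) :=
  (measurable_heatKernel n).ennreal_ofReal

lemma measurable_heatKernelENN_sub {n : ℕ} (t : ℝ) (x : Rn n) :
    Measurable (fun y => heatKernelENN n t (x - y)) :=
  (measurable_heatKernelENN n).comp (by fun_prop : Measurable fun y : Rn n => (t, x - y))

lemma heatKernel_sub_comm {n : ℕ} (t : ℝ) (x y : Rn n) :
    heatKernel n t (x - y) = heatKernel n t (y - x) := by
  unfold heatKernel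
  rw [norm_sub_rev]

lemma heatKernelENN_sub_comm {n : ℕ} (t : ℝ) (x y : Rn n) :
    heatKernelENN n t (x - y) = heatKernelENN n t (y - x) := by
  unfold heatKernelENN
  rw [heatKernel_sub_comm]

lemma integral_heatKernel (n : ℕ) {t : ℝ} (ht : 0 < t) : ∫ x, heatKernel n t x = 1 := by
  unfold heatKernel
  rw [integral_const_mul]
  have h := GaussianFourier.integral_rexp_neg_mul_sq_norm (V := Rn n)
    (b := 1 / (4 * t)) (by positivity)
  have e : ∀ x : Rn n, Real.exp (-‖x‖ ^ 2 / (4 * t)) = Real.exp (-(1 / (4 * t)) * ‖x‖ ^ 2) := by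
    intro x
    congr 1
    ring
  simp_rw [e, h]
  rw [finrank_euclideanSpace_fin, show Real.pi / (1 / (4 * t)) = 4 * Real.pi * t by
    field_simp, ← Real.rpow_add (by positivity)]
  rw [show -(n : ℝ) / 2 + (n : ℝ) / 2 = 0 by ring, Real.rpow_zero]

lemma integrable_heatKernel (n : ℕ) {t : ℝ} (ht : 0 < t) : Integrable (heatKernel n t) := by
  by_contra h
  have := integral_heatKernel n ht
  rw [integral_undef h] at this
  exact zero_ne_one this

lemma lintegral_heatKernelENN (n : ℕ) {t : ℝ} (ht : 0 < t) : ∫⁻ x, heatKernelENN n t x = 1 := by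
  unfold heatKernelENN
  rw [← ofReal_integral_eq_lintegral_ofReal (integrable_heatKernel n ht)
    (ae_of_all _ (heatKernel_nonneg n ht.le)), integral_heatKernel n ht, ENNReal.ofReal_one]

lemma lintegral_heatKernelENN_sub {n : ℕ} {t : ℝ} (ht : 0 < t) (x : Rn n) :
    ∫⁻ y, heatKernelENN n t (x - y) = 1 := by
  rw [lintegral_sub_left_eq_self (fun y => heatKernelENN n t y), lintegral_heatKernelENN n ht]

/-- The kernel decreases radially. For `c` at or above the peak the logarithm is nonpositive,
`Real.sqrt` returns `0` and the ball is empty, so no case distinction is needed. -/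
lemma setOf_lt_heatKernel {n : ℕ} {t c : ℝ} (ht : 0 < t) (hc : 0 < c) (x : Rn n) :
    {y | c < heatKernel n t (x - y)} = Metric.ball x
      (Real.sqrt (4 * t * Real.log ((4 * Real.pi * t) ^ (-(n : ℝ) / 2) / c))) := by
  ext y
  have hA : 0 < (4 * Real.pi * t) ^ (-(n : ℝ) / 2) := by positivity
  rw [mem_ofPred_eq, Metric.mem_ball, dist_comm, dist_eq_norm, Real.lt_sqrt (norm_nonneg _)]
  unfold heatKernel
  generalize (4 * Real.pi * t) ^ (-(n : ℝ) / 2) = A at hA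
  rw [← div_lt_iff₀' hA, ← Real.log_lt_iff_lt_exp (by positivity), ← inv_div, Real.log_inv,
    neg_div, neg_lt_neg_iff, div_lt_iff₀' (by positivity)]

/-- If all balls about `x` have `ν`-measure at most `A` times their volume, then so does the
heat kernel, being a superposition of balls. -/
lemma lintegral_heatKernelENN_le_of_ball {n : ℕ} {t : ℝ} (ht : 0 < t) (ν : Measure (Rn n))
    (x : Rn n) {A : ℝ≥0∞} (h : ∀ r > 0, ν (Metric.ball x r) ≤ A * volume (Metric.ball x r)) :
    ∫⁻ y, heatKernelENN n t (x - y) ∂ν ≤ A := by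
  rcases eq_or_ne A ⊤ with rfl | hA
  · exact le_top
  have hm : Measurable fun y => heatKernel n t (x - y) :=
    (measurable_heatKernel n).comp (by fun_prop : Measurable fun y : Rn n => (t, x - y))
  have key : ∀ μ : Measure (Rn n), ∫⁻ y, heatKernelENN n t (x - y) ∂μ =
      ∫⁻ c in Ioi (0 : ℝ), μ {y | c < heatKernel n t (x - y)} := fun μ =>
    lintegral_eq_lintegral_meas_lt μ (ae_of_all _ fun y => heatKernel_nonneg n ht.le _)
      hm.aemeasurable
  calc ∫⁻ y, heatKernelENN n t (x - y) ∂ν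
      = ∫⁻ c in Ioi (0 : ℝ), ν {y | c < heatKernel n t (x - y)} := key ν
    _ ≤ ∫⁻ c in Ioi (0 : ℝ), A * volume {y | c < heatKernel n t (x - y)} := by
        refine setLIntegral_mono' measurableSet_Ioi fun c hc => ?_
        rw [setOf_lt_heatKernel ht hc]
        rcases (Real.sqrt_nonneg (4 * t * Real.log
          ((4 * Real.pi * t) ^ (-(n : ℝ) / 2) / c))).eq_or_lt with h0 | h0
        · rw [← h0]
          simp
        · exact h _ h0
    _ = A * ∫⁻ y, heatKernelENN n t (x - y) := by
        rw [lintegral_const_mul' _ _ hA, key volume]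
    _ = A := by rw [lintegral_heatKernelENN_sub ht, mul_one]

lemma heatKernel_le (n : ℕ) {t : ℝ} (ht : 0 < t) (x : Rn n) :
    heatKernel n t x ≤ (4 * Real.pi * t) ^ (-(n : ℝ) / 2) := by
  unfold heatKernel
  refine mul_le_of_le_one_right (by positivity) (Real.exp_le_one_iff.2 ?_)
  exact div_nonpos_of_nonpos_of_nonneg (by simp) (by positivity)

/-- Comparison of heat kernels at two times. -/
lemma heatKernel_le_mul (n : ℕ) {s t : ℝ} (hs : 0 < s) (hst : s ≤ t) (x : Rn n) :
    heatKernel n s x ≤ (t / s) ^ ((n : ℝ) / 2) * heatKernel n t x := by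
  have ht : 0 < t := hs.trans_le hst
  unfold heatKernel
  rw [← mul_assoc]
  have e : (4 * Real.pi * s) ^ (-(n : ℝ) / 2) =
      (t / s) ^ ((n : ℝ) / 2) * (4 * Real.pi * t) ^ (-(n : ℝ) / 2) := by
    rw [show 4 * Real.pi * t = (t / s) * (4 * Real.pi * s) by field_simp,
      Real.mul_rpow (x := t / s) (by positivity) (by positivity), ← mul_assoc,
      ← Real.rpow_add (by positivity),
      show (n : ℝ) / 2 + -(n : ℝ) / 2 = 0 by ring, Real.rpow_zero, one_mul]
  rw [← e]
  gcongr ?_ * Real.exp ?_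
  rw [neg_div, neg_div, neg_le_neg_iff]
  gcongr

/-! ### Convergence of the heat extension at Lebesgue points. -/

lemma locallyIntegrable_of_integrable_heatKernel_mul {n : ℕ} {U : Rn n → ℝ} {t : ℝ} (ht : 0 < t)
    {x : Rn n} (h : Integrable (fun y => heatKernel n t (x - y) * U y)) :
    LocallyIntegrable U := by
  have hpos : ∀ y, heatKernel n t (x - y) ≠ 0 := fun y => by
    unfold heatKernel
    positivity
  have hc : Continuous fun y => (heatKernel n t (x - y))⁻¹ := by
    refine Continuous.inv₀ ?_ hpos
    unfold heatKernel
    fun_prop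
  have := (h.locallyIntegrable.locallyIntegrableOn univ).continuousOn_mul hc.continuousOn
    isOpen_univ.isLocallyClosed
  rw [locallyIntegrableOn_univ] at this
  refine this.congr (ae_of_all _ fun y => ?_)
  simp [hpos y]

/-- Controls the tail by the kernel at a fixed time `t`, against which the data are integrable; for
`R > 0` the prefactor tends to `0` with `s`. -/
lemma heatKernel_le_mul_of_le_norm {n : ℕ} {s t R : ℝ} (hs : 0 < s) (hst : s ≤ t) (hR : 0 ≤ R)
    {x : Rn n} (hx : R ≤ ‖x‖) :
    heatKernel n s x ≤ (t / s) ^ ((n : ℝ) / 2) *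
      Real.exp (-R ^ 2 * (1 / (4 * s) - 1 / (4 * t))) * heatKernel n t x := by
  have ht : 0 < t := hs.trans_le hst
  unfold heatKernel
  have e : (4 * Real.pi * s) ^ (-(n : ℝ) / 2) =
      (t / s) ^ ((n : ℝ) / 2) * (4 * Real.pi * t) ^ (-(n : ℝ) / 2) := by
    rw [show 4 * Real.pi * t = (t / s) * (4 * Real.pi * s) by field_simp,
      Real.mul_rpow (x := t / s) (by positivity) (by positivity), ← mul_assoc,
      ← Real.rpow_add (by positivity),
      show (n : ℝ) / 2 + -(n : ℝ) / 2 = 0 by ring, Real.rpow_zero, one_mul]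
  rw [e, show ∀ a b c d : ℝ, a * b * (c * d) = a * c * (b * d) by intros; ring, ← Real.exp_add]
  gcongr ?_ * Real.exp ?_
  have h1 : 0 ≤ 1 / (4 * s) - 1 / (4 * t) := by
    rw [sub_nonneg]
    gcongr
  have h2 : R ^ 2 * (1 / (4 * s) - 1 / (4 * t)) ≤ ‖x‖ ^ 2 * (1 / (4 * s) - 1 / (4 * t)) := by
    gcongr
  have h3 : -‖x‖ ^ 2 / (4 * s) = -(‖x‖ ^ 2 * (1 / (4 * s) - 1 / (4 * t))) + -‖x‖ ^ 2 / (4 * t) := by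
    ring
  rw [h3]
  linarith

lemma tendsto_heatKernel_tail_factor (n : ℕ) {t R : ℝ} (ht : 0 < t) (hR : 0 < R) :
    Tendsto (fun s : ℝ => (t / s) ^ ((n : ℝ) / 2) *
      Real.exp (-R ^ 2 * (1 / (4 * s) - 1 / (4 * t)))) (𝓝[>] 0) (𝓝 0) := by
  have h1 := (tendsto_rpow_mul_exp_neg_mul_atTop_nhds_zero ((n : ℝ) / 2) (R ^ 2 / (4 * t))
    (by positivity)).comp (tendsto_inv_nhdsGT_zero.const_mul_atTop ht)
  have h2 := h1.mul_const (Real.exp (R ^ 2 / (4 * t)))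
  rw [zero_mul] at h2
  refine h2.congr' ?_
  filter_upwards [self_mem_nhdsWithin] with s hs
  have hs : 0 < s := hs
  simp only [Function.comp]
  rw [mul_assoc, ← Real.exp_add, ← div_eq_mul_inv]
  congr 2
  field_simp
  ring

/-- At almost every point, averages over small balls of `|U - U(x)|` are small. -/
lemma ae_ball_lintegral_enorm_sub_le {n : ℕ} {U : Rn n → ℝ} (hU : LocallyIntegrable U) :
    ∀ᵐ x : Rn n, ∀ ε : ℝ≥0∞, ε ≠ 0 → ∃ R > 0, ∀ r ∈ Ioc 0 R,
      ∫⁻ y in Metric.ball x r, ‖U y - U x‖ₑ ≤ ε * volume (Metric.ball x r) := by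
  filter_upwards [(IsUnifLocDoublingMeasure.vitaliFamily (volume : Measure (Rn n))
    1).ae_tendsto_lintegral_enorm_sub_div hU] with x hx ε hε
  have h1 := hx.comp (IsUnifLocDoublingMeasure.tendsto_closedBall_filterAt (volume : Measure (Rn n))
    (K := 1) (x := x) (l := 𝓝[>] (0 : ℝ)) (fun _ => x) (fun r => r) tendsto_id (by
      filter_upwards [self_mem_nhdsWithin] with r hr
      have hr : 0 < r := hr
      exact Metric.mem_closedBall_self (by simpa using hr.le)))
  have h2 := h1.eventually (ge_mem_nhds (pos_iff_ne_zero.2 hε))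
  obtain ⟨R, hR, h3⟩ := mem_nhdsGT_iff_exists_Ioc_subset.1 h2
  refine ⟨R, hR, fun r hr => ?_⟩
  have h4 := h3 hr
  simp only [mem_ofPred_eq, Function.comp] at h4
  have hv : volume (Metric.closedBall x r) = volume (Metric.ball x r) := by
    rw [Measure.addHaar_closedBall _ _ hr.1.le, Measure.addHaar_ball_of_pos _ _ hr.1]
  rw [ENNReal.div_le_iff (Metric.measure_closedBall_pos _ _ hr.1).ne'
    measure_closedBall_lt_top.ne, hv] at h4
  exact (lintegral_mono_set Metric.ball_subset_closedBall).trans h4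

/-- The heat extension converges to its boundary values almost everywhere. -/
lemma ae_tendsto_heatExtension {n : ℕ} {U : Rn n → ℝ} {t₁ : ℝ} (ht₁ : 0 < t₁)
    (hint : ∀ x, Integrable (fun y => heatKernel n t₁ (x - y) * U y)) :
    ∀ᵐ x : Rn n, Tendsto (fun t => heatExtension U x t) (𝓝[>] 0) (𝓝 (U x)) := by
  have hloc := locallyIntegrable_of_integrable_heatKernel_mul ht₁ (hint 0)
  filter_upwards [ae_ball_lintegral_enorm_sub_le hloc] with x hx
  have hK : ∀ t, 0 < t → Integrable (fun y => heatKernel n t (x - y)) := fun t ht =>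
    (integrable_heatKernel n ht).comp_sub_left x
  have hmK : ∀ t, Measurable fun y => heatKernel n t (x - y) := fun t =>
    (measurable_heatKernel n).comp (by fun_prop : Measurable fun y : Rn n => (t, x - y))
  have hg : AEMeasurable (fun y => ‖U y - U x‖ₑ) :=
    (hloc.aestronglyMeasurable.sub aestronglyMeasurable_const).enorm
  have hI : ∫⁻ y, heatKernelENN n t₁ (x - y) * ‖U y - U x‖ₑ ≠ ⊤ := by
    have : Integrable (fun y => heatKernel n t₁ (x - y) * (U y - U x)) := by
      simp_rw [mul_sub]
      exact (hint x).sub ((hK t₁ ht₁).mul_const _)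
    convert this.hasFiniteIntegral.ne using 3 with y
    rw [enorm_mul, Real.enorm_of_nonneg (heatKernel_nonneg n ht₁.le _)]
    rfl
  -- the difference is bounded by an integral of `|U - U(x)|` against the kernel
  have hdiff : ∀ t ∈ Ioc 0 t₁, ‖heatExtension U x t - U x‖ₑ ≤
      ∫⁻ y, heatKernelENN n t (x - y) * ‖U y - U x‖ₑ := by
    intro t ht
    have i1 : Integrable (fun y => heatKernel n t (x - y) * U y) := by
      refine Integrable.mono' ((hint x).norm.const_mul ((t₁ / t) ^ ((n : ℝ) / 2)))
        ((hmK t).aestronglyMeasurable.mul hloc.aestronglyMeasurable) (ae_of_all _ fun y => ?_)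
      rw [norm_mul, norm_mul, ← mul_assoc, Real.norm_of_nonneg (heatKernel_nonneg n ht.1.le _),
        Real.norm_of_nonneg (heatKernel_nonneg n ht₁.le _)]
      gcongr
      exact heatKernel_le_mul n ht.1 ht.2 _
    have e : heatExtension U x t - U x = ∫ y, heatKernel n t (x - y) * (U y - U x) := by
      simp_rw [mul_sub]
      rw [integral_sub i1 ((hK t ht.1).mul_const _), integral_mul_const,
        integral_sub_left_eq_self (fun y => heatKernel n t y), integral_heatKernel n ht.1, one_mul]
      rfl
    rw [e]
    refine (enorm_integral_le_lintegral_enorm _).trans_eq (lintegral_congr fun y => ?_)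
    rw [enorm_mul, Real.enorm_of_nonneg (heatKernel_nonneg n ht.1.le _)]
    rfl
  rw [tendsto_iff_edist_tendsto_0, ENNReal.tendsto_nhds_zero]
  intro ε hε
  have hε2 : ε / 2 ≠ 0 := (ENNReal.half_pos hε.ne').ne'
  obtain ⟨R, hR, hRball⟩ := hx (ε / 2) hε2
  have htail := (ENNReal.tendsto_ofReal (tendsto_heatKernel_tail_factor n ht₁ hR))
  have htail2 := ENNReal.Tendsto.mul_const htail (Or.inr hI)
  rw [ENNReal.ofReal_zero, zero_mul] at htail2
  filter_upwards [htail2.eventually (ge_mem_nhds (pos_iff_ne_zero.2 hε2)),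
    Ioc_mem_nhdsGT ht₁] with t h1 h2
  rw [edist_eq_enorm_sub]
  refine (hdiff t h2).trans ?_
  -- Inside the ball of radius `R` the averages of `|U - U(x)|` are small; outside, the tail factor
  -- is.
  rw [← lintegral_add_compl _ (Metric.isOpen_ball (x := x) (ε := R)).measurableSet,
    ← ENNReal.add_halves ε]
  gcongr
  -- Restricting the measure to the ball of radius `R` extends the average bound from radii at most
  -- `R` to all radii.
  · have := lintegral_heatKernelENN_le_of_ball h2.1
      ((volume.restrict (Metric.ball x R)).withDensity fun y => ‖U y - U x‖ₑ) x (A := ε / 2) ?_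
    · rw [lintegral_withDensity_eq_lintegral_mul₀ hg.restrict
        (measurable_heatKernelENN_sub t x).aemeasurable] at this
      simpa only [Pi.mul_apply, mul_comm] using this
    · intro r hr
      rw [withDensity_apply _ Metric.isOpen_ball.measurableSet,
        Measure.restrict_restrict Metric.isOpen_ball.measurableSet]
      have hsub : Metric.ball x r ∩ Metric.ball x R = Metric.ball x (min r R) := by
        ext y
        simp
      rw [hsub]
      refine (hRball _ ⟨lt_min hr hR, min_le_right _ _⟩).trans ?_
      gcongr
      exact min_le_left _ _
  · refine le_trans ?_ h1
    rw [← lintegral_const_mul' _ _ ENNReal.ofReal_ne_top]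
    refine (setLIntegral_mono' Metric.isOpen_ball.measurableSet.compl fun y hy => ?_).trans
      (setLIntegral_le_lintegral _ _)
    rw [← mul_assoc]
    gcongr
    unfold heatKernelENN
    rw [← ENNReal.ofReal_mul (by have := h2.1; positivity)]
    refine ENNReal.ofReal_le_ofReal (heatKernel_le_mul_of_le_norm h2.1 h2.2 hR.le ?_)
    simpa [dist_eq_norm, norm_sub_rev] using hy

/-! ### The heat maximal function: weak-type and Kolmogorov estimates. -/

/-- Vitali's lemma selects disjoint balls whose fourfold enlargements cover the set, hence `4 ^ n`.
The selection needs bounded radii; the bound `R` does not enter the constant and is removed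
afterwards. -/
lemma vitali_weak_type_of_radius_le {n : ℕ} (ν : Measure (Rn n)) (c : ℝ≥0∞) (R : ℝ) :
    c * volume {x | ∃ r ∈ Ioc 0 R, c * volume (Metric.ball x r) < ν (Metric.ball x r)} ≤
      4 ^ n * ν univ := by
  set S := {x | ∃ r ∈ Ioc 0 R, c * volume (Metric.ball x r) < ν (Metric.ball x r)} with hS
  choose! r hr hlt using fun x (hx : x ∈ S) => hx
  obtain ⟨u, huS, hdisj, hcov⟩ := Vitali.exists_disjoint_subfamily_covering_enlargement_ball
    S id r R (fun x hx => (hr x hx).2) 4 (by norm_num)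
  simp only [id] at hdisj hcov
  have hcount : u.Countable := hdisj.countable_of_isOpen (fun x _ => Metric.isOpen_ball)
    (fun x hx => ⟨x, Metric.mem_ball_self (hr x (huS hx)).1⟩)
  have hsub : S ⊆ ⋃ x ∈ u, Metric.ball x (4 * r x) := fun x hx => by
    obtain ⟨b, hb, hxb⟩ := hcov x hx
    exact mem_biUnion hb (hxb (Metric.mem_ball_self (hr x hx).1))
  have hvol : ∀ x : Rn n, volume (Metric.ball x (4 * r x)) =
      4 ^ n * volume (Metric.ball x (r x)) := fun x => by
    rw [Measure.addHaar_ball_mul_of_pos _ _ (by norm_num), finrank_euclideanSpace_fin,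
      Measure.addHaar_ball_center _ x, ENNReal.ofReal_pow (by norm_num)]
    norm_num
  calc c * volume S ≤ c * volume (⋃ x ∈ u, Metric.ball x (4 * r x)) := by gcongr
    _ ≤ c * ∑' x : u, volume (Metric.ball x.1 (4 * r x)) := by
        gcongr
        exact measure_biUnion_le _ hcount _
    _ = 4 ^ n * ∑' x : u, c * volume (Metric.ball x.1 (r x)) := by
        simp_rw [hvol, ENNReal.tsum_mul_left]
        ring
    _ ≤ 4 ^ n * ∑' x : u, ν (Metric.ball x.1 (r x)) := by
        gcongr with x
        exact (hlt x.1 (huS x.2)).le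
    _ = 4 ^ n * ν (⋃ x ∈ u, Metric.ball x (r x)) := by
        rw [measure_biUnion hcount hdisj fun x _ => Metric.isOpen_ball.measurableSet]
    _ ≤ 4 ^ n * ν univ := by
        gcongr
        exact subset_univ _

/-- The weak-type `(1,1)` estimate for the maximal function of a measure. -/
lemma vitali_weak_type {n : ℕ} (ν : Measure (Rn n)) (c : ℝ≥0∞) :
    c * volume {x | ∃ r > 0, c * volume (Metric.ball x r) < ν (Metric.ball x r)} ≤
      4 ^ n * ν univ := by
  have e : {x | ∃ r > 0, c * volume (Metric.ball x r) < ν (Metric.ball x r)} =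
      ⋃ m : ℕ, {x | ∃ r ∈ Ioc 0 (m : ℝ), c * volume (Metric.ball x r) < ν (Metric.ball x r)} := by
    ext x
    simp only [mem_ofPred_eq, mem_iUnion]
    constructor
    · rintro ⟨r, hr, h⟩
      obtain ⟨m, hm⟩ := exists_nat_ge r
      exact ⟨m, r, ⟨hr, hm⟩, h⟩
    · rintro ⟨m, r, hr, h⟩
      exact ⟨r, hr.1, h⟩
  rw [e, Monotone.measure_iUnion, ENNReal.mul_iSup]
  · exact iSup_le fun m => vitali_weak_type_of_radius_le ν c m
  · rintro m m' hm x ⟨r, hr, h⟩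
    exact ⟨r, ⟨hr.1, hr.2.trans (by exact_mod_cast hm)⟩, h⟩

/-- The maximal function of the heat semigroup, taken over dyadic times. -/
noncomputable def heatMaximal {n : ℕ} (g : Rn n → ℝ≥0∞) (x : Rn n) : ℝ≥0∞ :=
  ⨆ j : ℤ, ∫⁻ y, heatKernelENN n ((2 : ℝ) ^ j) (x - y) * g y

lemma measurable_heatMaximal {n : ℕ} {f : Rn n → ℝ → ℝ≥0∞}
    (hf : Measurable (Function.uncurry f)) :
    Measurable (fun z : Rn n × ℝ => heatMaximal (fun y => f y z.2) z.1) := by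
  refine Measurable.iSup fun j => Measurable.lintegral_prod_right' (f := fun w :
    (Rn n × ℝ) × Rn n => heatKernelENN n ((2 : ℝ) ^ j) (w.1.1 - w.2) * f w.2 w.1.2) ?_
  exact ((measurable_heatKernelENN n).comp (by fun_prop : Measurable fun w :
    (Rn n × ℝ) × Rn n => ((2 : ℝ) ^ j, w.1.1 - w.2))).mul
    (hf.comp (by fun_prop : Measurable fun w : (Rn n × ℝ) × Rn n => (w.2, w.1.2)))

/-- Passing from `t` to the next dyadic time costs at most `2^{n/2}`, so a countable supremum, which
is visibly measurable, controls all times. -/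
lemma lintegral_heatKernelENN_mul_le_heatMaximal {n : ℕ} {t : ℝ} (ht : 0 < t)
    (g : Rn n → ℝ≥0∞) (x : Rn n) :
    ∫⁻ y, heatKernelENN n t (x - y) * g y ≤
      ENNReal.ofReal (2 ^ ((n : ℝ) / 2)) * heatMaximal g x := by
  obtain ⟨j, hj⟩ := exists_mem_Ioc_zpow ht (one_lt_two (α := ℝ))
  have h2 : (2 : ℝ) ^ (j + 1) ≤ 2 * t := by
    rw [zpow_add_one₀ (by norm_num)]
    linarith [hj.1]
  refine le_trans ?_ (mul_le_mul_right (le_iSup _ (j + 1)) _)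
  rw [← lintegral_const_mul' _ _ ENNReal.ofReal_ne_top]
  refine lintegral_mono fun y => ?_
  rw [← mul_assoc]
  gcongr
  unfold heatKernelENN
  rw [← ENNReal.ofReal_mul (by positivity)]
  refine ENNReal.ofReal_le_ofReal ((heatKernel_le_mul n ht hj.2 _).trans ?_)
  refine mul_le_mul_of_nonneg_right ?_ (heatKernel_nonneg n (by positivity) _)
  gcongr
  rwa [div_le_iff₀ ht]

/-- The kernel is a superposition of balls, so where the heat maximal function exceeds `c` some ball
has average above `c`. -/
lemma heatMaximal_weak_type {n : ℕ} {g : Rn n → ℝ≥0∞} (hg : Measurable g) (c : ℝ≥0∞) :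
    c * volume {x | c < heatMaximal g x} ≤ 4 ^ n * ∫⁻ y, g y := by
  have := vitali_weak_type (volume.withDensity g) c
  rw [withDensity_apply _ MeasurableSet.univ, setLIntegral_univ] at this
  refine le_trans ?_ this
  gcongr
  intro hx
  by_contra hcon
  simp only [not_exists, not_and, not_lt] at hcon
  refine hx.not_ge (iSup_le fun j => ?_)
  have h := lintegral_heatKernelENN_le_of_ball (t := (2 : ℝ) ^ j) (by positivity)
    (volume.withDensity g) x hcon
  rw [lintegral_withDensity_eq_lintegral_mul _ hg (measurable_heatKernelENN_sub _ x)] at h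
  simpa only [Pi.mul_apply, mul_comm] using h

/-- Splitting at height `l`: above it, `a = a^{1-b} a^b ≤ l^{1-b} a^b`. This deduces weak type
`(b,b)` from weak type `(1,1)` applied to `g^b`. -/
lemma ENNReal.le_add_rpow_mul {a l : ℝ≥0∞} (hl0 : l ≠ 0) (hl : l ≠ ⊤) {b : ℝ} (hb : 1 < b) :
    a ≤ l + l ^ (1 - b) * a ^ b := by
  rcases le_total a l with h | h
  · exact h.trans le_self_add
  · refine le_trans ?_ le_add_self
    rcases eq_or_ne a ⊤ with rfl | ha
    · rw [ENNReal.top_rpow_of_pos (by linarith), ENNReal.mul_top]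
      exact (ENNReal.rpow_pos (pos_iff_ne_zero.2 hl0) hl).ne'
    · have ha0 : a ≠ 0 := fun h0 => hl0 (le_antisymm (h0 ▸ h) bot_le)
      calc a = a ^ (1 - b) * a ^ b := by
            rw [← ENNReal.rpow_add _ _ ha0 ha, sub_add_cancel, ENNReal.rpow_one]
        _ ≤ l ^ (1 - b) * a ^ b := by
            gcongr ?_ * _
            rw [show 1 - b = -(b - 1) by ring, ENNReal.rpow_neg, ENNReal.rpow_neg,
              ENNReal.inv_le_inv]
            exact ENNReal.rpow_le_rpow h (by linarith)

/-- The weak-type `(b,b)` estimate for the maximal function of the heat semigroup. -/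
lemma heatMaximal_weak_type_rpow {n : ℕ} {g : Rn n → ℝ≥0∞} (hg : Measurable g) {l : ℝ≥0∞}
    (hl0 : l ≠ 0) (hl : l ≠ ⊤) {b : ℝ} (hb : 1 < b) :
    volume {x | 2 * l < heatMaximal g x} ≤ 4 ^ n * l ^ (-b) * ∫⁻ y, g y ^ b := by
  have hH : ∀ x, heatMaximal g x ≤ l + l ^ (1 - b) * heatMaximal (fun y => g y ^ b) x := by
    intro x
    refine iSup_le fun j => ?_
    calc ∫⁻ y, heatKernelENN n ((2 : ℝ) ^ j) (x - y) * g y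
        ≤ ∫⁻ y, (heatKernelENN n ((2 : ℝ) ^ j) (x - y) * l +
            l ^ (1 - b) * (heatKernelENN n ((2 : ℝ) ^ j) (x - y) * g y ^ b)) := by
          refine lintegral_mono fun y => ?_
          rw [mul_left_comm, ← mul_add]
          gcongr
          exact ENNReal.le_add_rpow_mul hl0 hl hb
      _ = l + l ^ (1 - b) * ∫⁻ y, heatKernelENN n ((2 : ℝ) ^ j) (x - y) * g y ^ b := by
          rw [lintegral_add_left ((measurable_heatKernelENN_sub _ x).mul_const _),
            lintegral_mul_const _ (measurable_heatKernelENN_sub _ x),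
            lintegral_heatKernelENN_sub (by positivity), one_mul,
            lintegral_const_mul' _ _ (ENNReal.rpow_ne_top_of_ne_zero hl0 hl)]
      _ ≤ _ := by
          gcongr
          exact le_iSup (fun j : ℤ =>
            ∫⁻ y, heatKernelENN n ((2 : ℝ) ^ j) (x - y) * g y ^ b) j
  have hsub : {x | 2 * l < heatMaximal g x} ⊆ {x | l ^ b < heatMaximal (fun y => g y ^ b) x} := by
    intro x (hx : 2 * l < heatMaximal g x)
    have h1 := hx.trans_le (hH x)
    rw [two_mul] at h1
    have h2 := lt_of_add_lt_add_left h1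
    have h3 : l ^ (b - 1) * l < l ^ (b - 1) * (l ^ (1 - b) * heatMaximal (fun y => g y ^ b) x) :=
      ENNReal.mul_lt_mul_right (ENNReal.rpow_pos (pos_iff_ne_zero.2 hl0) hl).ne'
        (ENNReal.rpow_ne_top_of_ne_zero hl0 hl) h2
    rw [← mul_assoc, ← ENNReal.rpow_add _ _ hl0 hl, show b - 1 + (1 - b) = 0 by ring,
      ENNReal.rpow_zero, one_mul] at h3
    nth_rw 2 [← ENNReal.rpow_one l] at h3
    rwa [← ENNReal.rpow_add _ _ hl0 hl, sub_add_cancel] at h3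
  refine (measure_mono hsub).trans ?_
  have h := heatMaximal_weak_type (hg.pow_const b) (l ^ b)
  have hlb0 : l ^ b ≠ 0 := (ENNReal.rpow_pos (pos_iff_ne_zero.2 hl0) hl).ne'
  have hlb : l ^ b ≠ ⊤ := ENNReal.rpow_ne_top_of_ne_zero hl0 hl
  rw [ENNReal.rpow_neg, mul_right_comm, ← div_eq_mul_inv,
    ENNReal.le_div_iff_mul_le (Or.inl hlb0) (Or.inl hlb), mul_comm]
  exact h

/-- The layer-cake bound for functions that may be infinite: if they are so on a set of positive
measure, the right side is infinite too. -/
lemma lintegral_le_lintegral_meas_lt {X : Type*} [MeasurableSpace X] (μ : Measure X)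
    {f : X → ℝ≥0∞} (hf : Measurable f) :
    ∫⁻ x, f x ∂μ ≤ ∫⁻ c in Ioi (0 : ℝ), μ {x | ENNReal.ofReal c < f x} := by
  by_cases h : μ {x | f x = ⊤} = 0
  · have hae : ∀ᵐ x ∂μ, f x ≠ ⊤ := by
      rw [ae_iff]
      simpa using h
    have e : ∫⁻ x, f x ∂μ = ∫⁻ x, ENNReal.ofReal (f x).toReal ∂μ :=
      lintegral_congr_ae (hae.mono fun x hx => (ENNReal.ofReal_toReal hx).symm)
    rw [e, lintegral_eq_lintegral_meas_lt μ (ae_of_all _ fun x => ENNReal.toReal_nonneg)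
      hf.ennreal_toReal.aemeasurable]
    refine setLIntegral_mono' measurableSet_Ioi fun c hc => measure_mono fun x hx => ?_
    exact ENNReal.ofReal_lt_iff_lt_toReal (le_of_lt hc)
      (fun h => by simp [h] at hx; exact absurd hx (not_lt.2 (le_of_lt hc))) |>.2 hx
  · refine le_trans le_top ?_
    calc (⊤ : ℝ≥0∞) = ∫⁻ c in Ioi (0 : ℝ), μ {x | f x = ⊤} := by
          rw [setLIntegral_const, Real.volume_Ioi, ENNReal.mul_top h]
      _ ≤ _ := by
          refine lintegral_mono fun c => measure_mono fun x hx => ?_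
          have hx : f x = ⊤ := hx
          simp [hx]

/-- Kolmogorov's inequality for the maximal function of the heat semigroup. -/
lemma setLIntegral_heatMaximal_le {n : ℕ} {b : ℝ} (hb : 1 < b) {E : Set (Rn n)}
    (hE : volume E ≠ ⊤) : ∃ K : ℝ≥0∞, K ≠ ⊤ ∧ ∀ g : Rn n → ℝ≥0∞, Measurable g →
      ∫⁻ x in E, heatMaximal g x ≤ K * ((∫⁻ y, g y ^ b) ^ (1 / b) + 1) := by
  -- With `A = ‖g‖_b + 1`, levels up to `2A` contribute at most `2A|E|`, and by weak type the higher
  -- ones at most `4^n ∫_{2A}^∞ (2A/c)^b dc = 4^n · 2A/(b-1)`. The `+ 1` keeps `A` positive.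
  refine ⟨2 * volume E + 4 ^ n * ENNReal.ofReal (2 / (b - 1)), by finiteness, fun g hg => ?_⟩
  have hHm : Measurable (heatMaximal g) :=
    Measurable.iSup fun j => Measurable.lintegral_prod_right' (f := fun w : Rn n × Rn n =>
      heatKernelENN n ((2 : ℝ) ^ j) (w.1 - w.2) * g w.2)
      (((measurable_heatKernelENN n).comp (by fun_prop : Measurable fun w : Rn n × Rn n =>
        ((2 : ℝ) ^ j, w.1 - w.2))).mul (hg.comp measurable_snd))
  rcases eq_or_ne ((∫⁻ y, g y ^ b) ^ (1 / b)) ⊤ with hN | hN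
  · have hK : 2 * volume E + 4 ^ n * ENNReal.ofReal (2 / (b - 1)) ≠ 0 := by
      have : (0 : ℝ) < 2 / (b - 1) := div_pos two_pos (by linarith)
      rw [Ne, add_eq_zero, not_and_or]
      exact Or.inr (mul_ne_zero (pow_ne_zero _ (by norm_num)) (ENNReal.ofReal_pos.2 this).ne')
    rw [hN, top_add, ENNReal.mul_top hK]
    exact le_top
  set A : ℝ := ((∫⁻ y, g y ^ b) ^ (1 / b)).toReal + 1 with hA
  have hA0 : 0 < A := by positivity
  have hAe : (∫⁻ y, g y ^ b) ^ (1 / b) + 1 = ENNReal.ofReal A := by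
    rw [hA, ENNReal.ofReal_add ENNReal.toReal_nonneg zero_le_one, ENNReal.ofReal_toReal hN,
      ENNReal.ofReal_one]
  have hgb : ∫⁻ y, g y ^ b ≤ ENNReal.ofReal (A ^ b) := by
    rw [← ENNReal.ofReal_rpow_of_pos hA0, ← hAe, ← ENNReal.rpow_inv_le_iff (by linarith),
      ← one_div]
    exact le_self_add
  rw [hAe]
  refine (lintegral_le_lintegral_meas_lt _ hHm).trans ?_
  rw [← Ioc_union_Ioi_eq_Ioi (show (0 : ℝ) ≤ 2 * A by positivity), add_mul]
  refine (lintegral_union_le _ _ _).trans (add_le_add ?_ ?_)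
  · calc ∫⁻ c in Ioc 0 (2 * A), (volume.restrict E) {x | ENNReal.ofReal c < heatMaximal g x}
        ≤ ∫⁻ c in Ioc 0 (2 * A), volume E := by
          refine lintegral_mono fun c => (measure_mono (subset_univ _)).trans_eq ?_
          exact Measure.restrict_apply_univ _
      _ = 2 * volume E * ENNReal.ofReal A := by
          rw [setLIntegral_const, Real.volume_Ioc, sub_zero, ENNReal.ofReal_mul two_pos.le]
          norm_num
          ring
  · have hrp : ∀ c ∈ Ioi (2 * A), (volume.restrict E) {x | ENNReal.ofReal c < heatMaximal g x} ≤
        4 ^ n * ENNReal.ofReal (2 ^ b * A ^ b) * ENNReal.ofReal (c ^ (-b)) := by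
      intro c hc
      have hc0 : 0 < c := (by positivity : 0 < 2 * A).trans hc
      have h := heatMaximal_weak_type_rpow hg (l := ENNReal.ofReal (c / 2))
        (by simpa using hc0) ENNReal.ofReal_ne_top hb
      rw [show 2 * ENNReal.ofReal (c / 2) = ENNReal.ofReal c by
        rw [← ENNReal.ofReal_ofNat, ← ENNReal.ofReal_mul two_pos.le]
        congr 1
        ring] at h
      refine (Measure.restrict_apply_le _ _).trans (h.trans ?_)
      calc 4 ^ n * ENNReal.ofReal (c / 2) ^ (-b) * ∫⁻ y, g y ^ b
          ≤ 4 ^ n * ENNReal.ofReal (c / 2) ^ (-b) * ENNReal.ofReal (A ^ b) := by gcongr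
        _ = _ := by
          rw [ENNReal.ofReal_rpow_of_pos (by positivity), mul_assoc, mul_assoc,
            ← ENNReal.ofReal_mul (by positivity), ← ENNReal.ofReal_mul (by positivity),
            Real.div_rpow hc0.le two_pos.le, Real.rpow_neg two_pos.le, div_inv_eq_mul]
          congr 2
          ring
    refine (setLIntegral_mono' measurableSet_Ioi hrp).trans_eq ?_
    rw [lintegral_const_mul' _ _ (by finiteness),
      ← ofReal_integral_eq_lintegral_ofReal
        (integrableOn_Ioi_rpow_of_lt (by linarith) (by positivity))
        ((ae_restrict_iff' measurableSet_Ioi).2 (ae_of_all _ fun c hc => by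
          have : 0 < c := (by positivity : 0 < 2 * A).trans hc
          positivity)),
      integral_Ioi_rpow_of_lt (by linarith) (by positivity), mul_assoc, mul_assoc,
      ← ENNReal.ofReal_mul (by positivity), ← ENNReal.ofReal_mul
        (div_nonneg two_pos.le (by linarith))]
    congr 2
    rw [← Real.mul_rpow two_pos.le hA0.le, Real.rpow_add (by positivity), Real.rpow_neg
      (by positivity), Real.rpow_one]
    have : (2 * A) ^ b ≠ 0 := by positivity
    have : -b + 1 ≠ 0 := by linarith
    have : b - 1 ≠ 0 := by linarith
    field_simp
    ring

/-- Kolmogorov's inequality on a ball is integrated in `s` and the integrals are swapped; its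
additive `1` costs only the finite length of the interval. Balls exhaust the space. -/
lemma ae_lintegral_heatMaximal_ne_top {n : ℕ} {b T : ℝ} (hb : 1 < b) {f : Rn n → ℝ → ℝ≥0∞}
    (hf : Measurable (Function.uncurry f))
    (hfin : ∫⁻ s in Ioo 0 T, (∫⁻ y, f y s ^ b) ^ (1 / b) ≠ ⊤) :
    ∀ᵐ x : Rn n, ∫⁻ s in Ioo 0 T, heatMaximal (fun y => f y s) x ≠ ⊤ := by
  have hm := measurable_heatMaximal hf
  have hball : ∀ m : ℕ, ∀ᵐ x ∂(volume.restrict (Metric.ball (0 : Rn n) m)),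
      ∫⁻ s in Ioo 0 T, heatMaximal (fun y => f y s) x < ⊤ := by
    intro m
    obtain ⟨K, hK, h⟩ := setLIntegral_heatMaximal_le hb
      (measure_ball_lt_top (x := (0 : Rn n)) (r := m) (μ := volume)).ne
    refine ae_lt_top hm.lintegral_prod_right' ?_
    rw [lintegral_lintegral_swap hm.aemeasurable]
    refine ne_top_of_le_ne_top ?_ (lintegral_mono fun s =>
      h (fun y => f y s) (hf.comp (by fun_prop : Measurable fun y : Rn n => (y, s))))
    rw [lintegral_const_mul' _ _ hK, lintegral_add_right _ measurable_const]
    refine ENNReal.mul_ne_top hK (ENNReal.add_ne_top.2 ⟨hfin, ?_⟩)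
    simp
  have : ∀ᵐ x ∂(volume.restrict (⋃ m : ℕ, Metric.ball (0 : Rn n) m)),
      ∫⁻ s in Ioo 0 T, heatMaximal (fun y => f y s) x < ⊤ := by
    rw [ae_restrict_iUnion_iff]
    exact hball
  rw [Metric.iUnion_ball_nat, Measure.restrict_univ] at this
  exact this.mono fun x hx => hx.ne

/-! ### Jensen, Minkowski and heat smoothing. -/

section Inequalities

variable {X S : Type*} [MeasurableSpace X] [MeasurableSpace S]

/-- Weighted Jensen inequality: `(∫ f g)^b ≤ (∫ f)^(b-1) ∫ f g^b`. -/
lemma ENNReal.lintegral_mul_rpow_le {μ : Measure X} {b : ℝ} (hb : 1 < b) {f g : X → ℝ≥0∞}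
    (hf : Measurable f) (hg : Measurable g) :
    (∫⁻ x, f x * g x ∂μ) ^ b ≤ (∫⁻ x, f x ∂μ) ^ (b - 1) * ∫⁻ x, f x * g x ^ b ∂μ := by
  have hc := Real.HolderConjugate.conjExponent hb
  -- Hölder for `g` and `1` with respect to the measure `f dμ`.
  have h := ENNReal.lintegral_mul_le_Lp_mul_Lq (μ.withDensity f) hc hg.aemeasurable
    (aemeasurable_const (b := (1 : ℝ≥0∞)))
  simp only [Pi.mul_apply, mul_one, ENNReal.one_rpow] at h
  rw [lintegral_withDensity_eq_lintegral_mul _ hf hg,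
    lintegral_withDensity_eq_lintegral_mul _ hf (hg.pow_const b),
    lintegral_withDensity_eq_lintegral_mul _ hf measurable_const] at h
  simp only [Pi.mul_apply, mul_one] at h
  refine (ENNReal.rpow_le_rpow h (by linarith)).trans_eq ?_
  rw [ENNReal.mul_rpow_of_nonneg _ _ (by linarith), ← ENNReal.rpow_mul, ← ENNReal.rpow_mul,
    mul_comm, one_div_mul_cancel (by linarith), ENNReal.rpow_one]
  congr 2
  rw [Real.conjExponent]
  have : b - 1 ≠ 0 := by linarith
  field_simp

/-- Minkowski's integral inequality, with a majorant for the norms of the slices. -/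
lemma lintegral_lintegral_rpow_le {μ : Measure X} {ν : Measure S} [SFinite μ] [IsFiniteMeasure ν]
    {p : ℝ} (hp : 1 < p) {F : X → S → ℝ≥0∞} (hF : Measurable (Function.uncurry F))
    {a : S → ℝ≥0∞} (ha : Measurable a) (h : ∀ᵐ s ∂ν, ∫⁻ x, F x s ^ p ∂μ ≤ a s ^ p) :
    ∫⁻ x, (∫⁻ s, F x s ∂ν) ^ p ∂μ ≤ (∫⁻ s, a s ∂ν) ^ p := by
  have hp0 : 0 < p := by linarith
  rcases eq_or_ne (∫⁻ s, a s ∂ν) ⊤ with htop | htop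
  · rw [htop, ENNReal.top_rpow_of_pos hp0]
    exact le_top
  -- Jensen with weight `a + ε` is applied to `F/(a + ε)`, whose slices have norm at most `1`. The
  -- `ε` prevents division by zero, and its cost `ε ν(univ)` vanishes because `ν` is finite.
  have key : ∀ ε : ℝ≥0∞, 0 < ε → ε ≠ ⊤ →
      ∫⁻ x, (∫⁻ s, F x s ∂ν) ^ p ∂μ ≤ (∫⁻ s, a s ∂ν + ε * ν univ) ^ p := by
    intro ε hε hεt
    have ha' : Measurable fun s => a s + ε := ha.add_const ε
    have hint : ∫⁻ s, (a s + ε) ∂ν = ∫⁻ s, a s ∂ν + ε * ν univ := by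
      rw [lintegral_add_right _ measurable_const, lintegral_const]
    have hfin : ∀ᵐ s ∂ν, a s ≠ ⊤ := (ae_lt_top ha htop).mono fun s hs => hs.ne
    have hFs : ∀ x, Measurable fun s => F x s := fun x => hF.comp measurable_prodMk_left
    have hG : Measurable (fun z : X × S => (a z.2 + ε) * (F z.1 z.2 / (a z.2 + ε)) ^ p) :=
      (ha'.comp measurable_snd).mul ((hF.div (ha'.comp measurable_snd)).pow_const p)
    rw [← hint]
    calc ∫⁻ x, (∫⁻ s, F x s ∂ν) ^ p ∂μ
        = ∫⁻ x, (∫⁻ s, (a s + ε) * (F x s / (a s + ε)) ∂ν) ^ p ∂μ := by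
          refine lintegral_congr fun x => ?_
          congr 1
          refine lintegral_congr_ae (hfin.mono fun s hs => ?_)
          exact (ENNReal.mul_div_cancel (by positivity) (ENNReal.add_ne_top.2 ⟨hs, hεt⟩)).symm
      _ ≤ ∫⁻ x, (∫⁻ s, (a s + ε) ∂ν) ^ (p - 1) *
            ∫⁻ s, (a s + ε) * (F x s / (a s + ε)) ^ p ∂ν ∂μ :=
          lintegral_mono fun x => ENNReal.lintegral_mul_rpow_le hp ha' ((hFs x).div ha')
      _ = (∫⁻ s, (a s + ε) ∂ν) ^ (p - 1) *
            ∫⁻ s, ∫⁻ x, (a s + ε) * (F x s / (a s + ε)) ^ p ∂μ ∂ν := by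
          rw [lintegral_const_mul _ hG.lintegral_prod_right', lintegral_lintegral_swap
            hG.aemeasurable]
      _ ≤ (∫⁻ s, (a s + ε) ∂ν) ^ (p - 1) * ∫⁻ s, (a s + ε) ∂ν := by
          gcongr 1
          refine lintegral_mono_ae ?_
          filter_upwards [h, hfin] with s hs hs'
          have h0 : (a s + ε) ^ p ≠ 0 := (ENNReal.rpow_pos (by positivity) (by finiteness)).ne'
          have ht : (a s + ε) ^ p ≠ ⊤ := by finiteness
          calc ∫⁻ x, (a s + ε) * (F x s / (a s + ε)) ^ p ∂μ
              = (a s + ε) * ((∫⁻ x, F x s ^ p ∂μ) / (a s + ε) ^ p) := by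
                simp_rw [ENNReal.div_rpow_of_nonneg _ _ hp0.le, div_eq_mul_inv]
                rw [lintegral_const_mul' _ _ (by finiteness), lintegral_mul_const' _ _ (by
                  exact ENNReal.inv_ne_top.2 h0)]
            _ ≤ (a s + ε) * 1 := by
                gcongr
                refine ENNReal.div_le_of_le_mul ?_
                rw [one_mul]
                refine hs.trans ?_
                gcongr
                exact le_self_add
            _ = a s + ε := mul_one _
      _ = (∫⁻ s, (a s + ε) ∂ν) ^ p := by
          nth_rw 2 [← ENNReal.rpow_one (∫⁻ s, (a s + ε) ∂ν)]
          rw [← ENNReal.rpow_add_of_nonneg _ _ (by linarith) zero_le_one, sub_add_cancel]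
  have hlim : Tendsto (fun ε : ℝ≥0∞ => (∫⁻ s, a s ∂ν + ε * ν univ) ^ p) (𝓝[>] 0)
      (𝓝 ((∫⁻ s, a s ∂ν) ^ p)) := by
    have h1 : Tendsto (fun ε : ℝ≥0∞ => ε * ν univ) (𝓝[>] 0) (𝓝 (0 * ν univ)) :=
      ENNReal.Tendsto.mul_const (tendsto_id.mono_left nhdsWithin_le_nhds)
        (Or.inr (measure_ne_top _ _))
    have h2 := (tendsto_const_nhds (x := ∫⁻ s, a s ∂ν)).add h1
    rw [zero_mul, add_zero] at h2
    exact (ENNReal.continuous_rpow_const.tendsto _).comp h2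
  refine ge_of_tendsto hlim ?_
  filter_upwards [Ioo_mem_nhdsGT ENNReal.zero_lt_top] with ε hε
  exact key ε hε.1 hε.2.ne

end Inequalities

/-- The `L^b → L^p` smoothing estimate for the heat semigroup. -/
lemma lintegral_heat_rpow_le {n : ℕ} {τ b p : ℝ} (hτ : 0 < τ) (hb : 1 < b) (hbp : b ≤ p)
    {f : Rn n → ℝ≥0∞} (hf : Measurable f) :
    ∫⁻ x, (∫⁻ y, heatKernelENN n τ (x - y) * f y) ^ p ≤
      ENNReal.ofReal ((4 * Real.pi * τ) ^ (-(n : ℝ) / 2)) ^ ((p - b) / b) *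
        (∫⁻ y, f y ^ b) ^ (p / b) := by
  have hb0 : 0 < b := by linarith
  have hK2 : Measurable (fun z : Rn n × Rn n => heatKernelENN n τ (z.1 - z.2)) :=
    (measurable_heatKernelENN n).comp (by fun_prop : Measurable fun z : Rn n × Rn n =>
      (τ, z.1 - z.2))
  have hfb : Measurable fun y => f y ^ b := hf.pow_const b
  set N := ∫⁻ y, f y ^ b with hN
  set c := ENNReal.ofReal ((4 * Real.pi * τ) ^ (-(n : ℝ) / 2)) with hc
  have hjensen : ∀ x, (∫⁻ y, heatKernelENN n τ (x - y) * f y) ^ b ≤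
      ∫⁻ y, heatKernelENN n τ (x - y) * f y ^ b := by
    intro x
    have h := ENNReal.lintegral_mul_rpow_le (μ := volume) hb (measurable_heatKernelENN_sub τ x) hf
    rwa [lintegral_heatKernelENN_sub hτ, ENNReal.one_rpow, one_mul] at h
  have hsup : ∀ x, ∫⁻ y, heatKernelENN n τ (x - y) * f y ^ b ≤ c * N := by
    intro x
    rw [hN, ← lintegral_const_mul _ hfb]
    refine lintegral_mono fun y => ?_
    gcongr
    exact ENNReal.ofReal_le_ofReal (heatKernel_le n hτ _)
  have hmass : ∫⁻ x, ∫⁻ y, heatKernelENN n τ (x - y) * f y ^ b = N := by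
    rw [lintegral_lintegral_swap (hK2.mul (hfb.comp measurable_snd)).aemeasurable]
    refine lintegral_congr fun y => ?_
    have hKy : Measurable fun x => heatKernelENN n τ (x - y) :=
      (measurable_heatKernelENN n).comp (by fun_prop : Measurable fun x : Rn n => (τ, x - y))
    rw [lintegral_mul_const _ hKy]
    simp_rw [heatKernelENN_sub_comm τ _ y]
    rw [lintegral_heatKernelENN_sub hτ, one_mul]
  have hd : 0 ≤ (p - b) / b := div_nonneg (by linarith) hb0.le
  calc ∫⁻ x, (∫⁻ y, heatKernelENN n τ (x - y) * f y) ^ p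
      ≤ ∫⁻ x, (c * N) ^ ((p - b) / b) * ∫⁻ y, heatKernelENN n τ (x - y) * f y ^ b := by
        refine lintegral_mono fun x => ?_
        -- Interpolation: the first part of the exponent uses the sup bound, the remaining `b` the
        -- conservation of mass.
        have e : p = b * ((p - b) / b) + b := by
          field_simp
          ring
        nth_rw 1 [e]
        rw [ENNReal.rpow_add_of_nonneg _ _ (by positivity) hb0.le, ENNReal.rpow_mul]
        gcongr
        · exact (hjensen x).trans (hsup x)
        · exact hjensen x
    _ = (c * N) ^ ((p - b) / b) * N := by
        have hJ : Measurable fun x => ∫⁻ y, heatKernelENN n τ (x - y) * f y ^ b :=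
          (hK2.mul (hfb.comp measurable_snd)).lintegral_prod_right'
        rw [lintegral_const_mul _ hJ, hmass]
    _ = c ^ ((p - b) / b) * N ^ (p / b) := by
        rw [ENNReal.mul_rpow_of_nonneg _ _ hd, mul_assoc]
        congr 1
        nth_rw 2 [← ENNReal.rpow_one N]
        rw [← ENNReal.rpow_add_of_nonneg _ _ hd zero_le_one]
        congr 1
        field_simp
        ring

/-! ### Singular time integrals and Hölder in time. -/

lemma setLIntegral_rpow_neg {κ a : ℝ} (hκ : κ < 1) (ha : 0 ≤ a) :
    ∫⁻ s in Ioo 0 a, ENNReal.ofReal (s ^ (-κ)) = ENNReal.ofReal (a ^ (1 - κ) / (1 - κ)) := by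
  have hi := (intervalIntegral.intervalIntegrable_rpow' (a := 0) (b := a)
    (show -1 < -κ by linarith))
  rw [intervalIntegrable_iff_integrableOn_Ioo_of_le ha] at hi
  rw [← ofReal_integral_eq_lintegral_ofReal hi ((ae_restrict_iff' measurableSet_Ioo).2
    (ae_of_all _ fun s hs => Real.rpow_nonneg hs.1.le _)), ← integral_Ioc_eq_integral_Ioo,
    ← intervalIntegral.integral_of_le ha, integral_rpow (Or.inl (by linarith)),
    Real.zero_rpow (by linarith)]
  congr 1
  rw [sub_zero]
  ring_nf

lemma setLIntegral_sub_rpow_neg {β t : ℝ} (hβ : β < 1) (ht : 0 ≤ t) :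
    ∫⁻ s in Ioo (t / 2) t, ENNReal.ofReal ((t - s) ^ (-β)) =
      ENNReal.ofReal ((t / 2) ^ (1 - β) / (1 - β)) := by
  rw [← setLIntegral_rpow_neg hβ (by positivity), ← lintegral_indicator measurableSet_Ioo,
    ← lintegral_indicator measurableSet_Ioo,
    ← lintegral_sub_left_eq_self _ t]
  refine lintegral_congr fun s => ?_
  simp only [indicator, mem_Ioo]
  congr 1
  · apply propext
    constructor <;> rintro ⟨h1, h2⟩ <;> constructor <;> linarith
  · rw [sub_sub_cancel]

/-- On each half of `(0,t)` only one factor is singular, and the other is at most its value at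
`t/2`. The `2` bounds `2^{β+κ-1}`. -/
lemma setLIntegral_beta_le {β κ : ℝ} (hβ0 : 0 ≤ β) (hβ : β < 1) (hκ0 : 0 ≤ κ) (hκ : κ < 1)
    {t : ℝ} (ht : 0 < t) :
    ∫⁻ s in Ioo 0 t, ENNReal.ofReal ((t - s) ^ (-β) * s ^ (-κ)) ≤
      ENNReal.ofReal (2 * (1 / (1 - κ) + 1 / (1 - β)) * t ^ (1 - β - κ)) := by
  have hsub : Ioo 0 t ⊆ Ioo 0 (t / 2) ∪ Icc (t / 2) (t / 2) ∪ Ioo (t / 2) t := by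
    intro s hs
    rcases lt_trichotomy s (t / 2) with h | h | h
    · exact Or.inl (Or.inl ⟨hs.1, h⟩)
    · exact Or.inl (Or.inr ⟨h.ge, h.le⟩)
    · exact Or.inr ⟨h, hs.2⟩
  have h2 : 0 < t / 2 := by positivity
  have hκ' : 0 < 1 - κ := by linarith
  have hβ' : 0 < 1 - β := by linarith
  calc ∫⁻ s in Ioo 0 t, ENNReal.ofReal ((t - s) ^ (-β) * s ^ (-κ))
      ≤ ∫⁻ s in Ioo 0 (t / 2) ∪ Icc (t / 2) (t / 2) ∪ Ioo (t / 2) t,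
          ENNReal.ofReal ((t - s) ^ (-β) * s ^ (-κ)) := lintegral_mono_set hsub
    _ ≤ ((∫⁻ s in Ioo 0 (t / 2), ENNReal.ofReal ((t - s) ^ (-β) * s ^ (-κ))) + 0) +
          ∫⁻ s in Ioo (t / 2) t, ENNReal.ofReal ((t - s) ^ (-β) * s ^ (-κ)) := by
        refine (lintegral_union_le _ _ _).trans (add_le_add ?_ le_rfl)
        refine (lintegral_union_le _ _ _).trans (add_le_add le_rfl ?_)
        rw [Icc_self, setLIntegral_measure_zero _ _ (by simp)]
    _ ≤ ((∫⁻ s in Ioo 0 (t / 2), ENNReal.ofReal ((t / 2) ^ (-β)) * ENNReal.ofReal (s ^ (-κ))) + 0) +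
          ∫⁻ s in Ioo (t / 2) t, ENNReal.ofReal ((t / 2) ^ (-κ)) *
            ENNReal.ofReal ((t - s) ^ (-β)) := by
        refine add_le_add (add_le_add ?_ le_rfl) ?_
        · refine setLIntegral_mono' measurableSet_Ioo fun s hs => ?_
          rw [← ENNReal.ofReal_mul (by positivity)]
          refine ENNReal.ofReal_le_ofReal ?_
          refine mul_le_mul_of_nonneg_right ?_ (Real.rpow_nonneg hs.1.le _)
          exact Real.rpow_le_rpow_of_nonpos h2 (by linarith [hs.2]) (by linarith)
        · refine setLIntegral_mono' measurableSet_Ioo fun s hs => ?_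
          rw [← ENNReal.ofReal_mul (by positivity), mul_comm]
          refine ENNReal.ofReal_le_ofReal ?_
          refine mul_le_mul_of_nonneg_right ?_ (Real.rpow_nonneg (by linarith [hs.2]) _)
          exact Real.rpow_le_rpow_of_nonpos h2 hs.1.le (by linarith)
    _ = ENNReal.ofReal ((t / 2) ^ (1 - β - κ) * (1 / (1 - κ) + 1 / (1 - β))) := by
        rw [lintegral_const_mul' _ _ ENNReal.ofReal_ne_top,
          lintegral_const_mul' _ _ ENNReal.ofReal_ne_top, setLIntegral_rpow_neg hκ h2.le,
          setLIntegral_sub_rpow_neg hβ ht.le, add_zero, ← ENNReal.ofReal_mul (by positivity),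
          ← ENNReal.ofReal_mul (by positivity), ← ENNReal.ofReal_add (by positivity)
          (by positivity), ← mul_div_assoc, ← mul_div_assoc, ← Real.rpow_add h2,
          ← Real.rpow_add h2]
        congr 1
        rw [show -β + (1 - κ) = 1 - β - κ by ring, show -κ + (1 - β) = 1 - β - κ by ring]
        ring
    _ ≤ _ := by
        refine ENNReal.ofReal_le_ofReal ?_
        rw [Real.div_rpow ht.le two_pos.le, div_eq_mul_inv, ← Real.rpow_neg two_pos.le]
        have : (2 : ℝ) ^ (-(1 - β - κ)) ≤ 2 ^ (1 : ℝ) :=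
          Real.rpow_le_rpow_of_exponent_le one_le_two (by linarith)
        rw [Real.rpow_one] at this
        calc t ^ (1 - β - κ) * 2 ^ (-(1 - β - κ)) * (1 / (1 - κ) + 1 / (1 - β))
            ≤ t ^ (1 - β - κ) * 2 * (1 / (1 - κ) + 1 / (1 - β)) := by gcongr
          _ = _ := by ring

/-- Hölder's inequality in time against the weight `s^k`. -/
lemma setLIntegral_time_holder {α q k γ : ℝ} (hα : 0 < α) (hαq : α < q) (hk : 0 ≤ k)
    (hκ : k * α / (q - α) < 1) (hγ : 0 ≤ γ) (hβ : γ * (q / (q - α)) < 1) :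
    ∃ C : ℝ, 0 < C ∧ ∀ t, 0 < t → ∀ m : ℝ → ℝ≥0∞, Measurable m →
      ∫⁻ s in Ioo 0 t, ENNReal.ofReal ((t - s) ^ (-γ)) * m s ^ α ≤
        ENNReal.ofReal (C * t ^ (1 - γ * (q / (q - α)) - k * α / (q - α))) ^ ((q - α) / q) *
          (∫⁻ s in Ioo 0 t, m s ^ q * ENNReal.ofReal (s ^ k)) ^ (α / q) := by
  have hqα : 0 < q - α := by linarith
  have hq : 0 < q := by linarith
  set β := γ * (q / (q - α)) with hβdef
  set κ := k * α / (q - α) with hκdef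
  have hκ1 : 0 < 1 - κ := by linarith
  have hβ1 : 0 < 1 - β := by linarith
  refine ⟨2 * (1 / (1 - κ) + 1 / (1 - β)), by positivity, fun t ht m hm => ?_⟩
  have hconj : (q / (q - α)).HolderConjugate (q / α) := by
    rw [Real.holderConjugate_iff]
    constructor
    · rw [lt_div_iff₀ hqα]
      linarith
    · rw [inv_div, inv_div, ← add_div, sub_add_cancel, div_self hq.ne']
  -- The factors `s^{∓kα/q}` are inserted so that the power `q/α` of the second function is exactly
  -- `m^q s^k`, and the power `q/(q-α)` of the first is `(t-s)^{-β} s^{-κ}`.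
  have h := ENNReal.lintegral_mul_le_Lp_mul_Lq (volume.restrict (Ioo 0 t)) hconj
    (f := fun s => ENNReal.ofReal ((t - s) ^ (-γ) * s ^ (-(k * α / q))))
    (g := fun s => m s ^ α * ENNReal.ofReal (s ^ (k * α / q)))
    (by fun_prop) (by fun_prop)
  rw [one_div_div, one_div_div] at h
  calc ∫⁻ s in Ioo 0 t, ENNReal.ofReal ((t - s) ^ (-γ)) * m s ^ α
      = ∫⁻ s in Ioo 0 t, ENNReal.ofReal ((t - s) ^ (-γ) * s ^ (-(k * α / q))) *
          (m s ^ α * ENNReal.ofReal (s ^ (k * α / q))) := by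
        refine setLIntegral_congr_fun measurableSet_Ioo fun s hs => ?_
        have hts : 0 ≤ (t - s) ^ (-γ) := Real.rpow_nonneg (by linarith [hs.2]) _
        have hs0 : 0 < s := hs.1
        rw [mul_comm (m s ^ α), ← mul_assoc, ← ENNReal.ofReal_mul (by positivity), mul_assoc,
          ← Real.rpow_add hs0, neg_add_cancel, Real.rpow_zero, mul_one]
    _ ≤ _ := h
    _ ≤ _ := by
        gcongr ?_ ^ _ * ?_ ^ _
        · refine le_trans (le_of_eq ?_)
            (setLIntegral_beta_le (mul_nonneg hγ (by positivity)) hβ (by positivity) hκ ht)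
          refine setLIntegral_congr_fun measurableSet_Ioo fun s hs => ?_
          have hts : 0 < t - s := by linarith [hs.2]
          have hs0 : 0 < s := hs.1
          rw [ENNReal.ofReal_rpow_of_nonneg (by positivity) (by positivity),
            Real.mul_rpow (by positivity) (by positivity), ← Real.rpow_mul hts.le,
            ← Real.rpow_mul hs0.le]
          congr 3
          · ring
          · rw [hκdef]
            field_simp
        · refine le_of_eq (setLIntegral_congr_fun measurableSet_Ioo fun s hs => ?_)
          have hs0 : 0 < s := hs.1
          rw [ENNReal.mul_rpow_of_nonneg _ _ (by positivity), ← ENNReal.rpow_mul,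
            ENNReal.ofReal_rpow_of_nonneg (by positivity) (by positivity), ← Real.rpow_mul hs0.le]
          congr 3 <;> field_simp

/-! ### The Duhamel operator on `[0,∞]`-valued functions. -/

/-- The Duhamel integral of a `[0, ∞]`-valued source. -/
noncomputable def heatDuhamel {n : ℕ} (f : Rn n → ℝ → ℝ≥0∞) (x : Rn n) (t : ℝ) : ℝ≥0∞ :=
  ∫⁻ s in Ioo 0 t, ∫⁻ y, heatKernelENN n (t - s) (x - y) * f y s

/-- The `q`-th power of the norm of `L^q((0,T), t^k dt; L^p)`, for `[0, ∞]`-valued functions. -/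
noncomputable def mixedNormPow {n : ℕ} (p q k T : ℝ) (F : Rn n → ℝ → ℝ≥0∞) : ℝ≥0∞ :=
  ∫⁻ t in Ioo 0 T, (∫⁻ x, F x t ^ p) ^ (q / p) * ENNReal.ofReal (t ^ k)

section Duhamel

variable {n : ℕ} {f g : Rn n → ℝ → ℝ≥0∞}

lemma measurable_heatDuhamel_inner (hf : Measurable (Function.uncurry f)) :
    Measurable (fun w : (Rn n × ℝ) × ℝ =>
      ∫⁻ y, heatKernelENN n (w.1.2 - w.2) (w.1.1 - y) * f y w.2) := by
  refine Measurable.lintegral_prod_right' (f := fun v : ((Rn n × ℝ) × ℝ) × Rn n =>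
    heatKernelENN n (v.1.1.2 - v.1.2) (v.1.1.1 - v.2) * f v.2 v.1.2) ?_
  exact ((measurable_heatKernelENN n).comp (by fun_prop : Measurable fun v :
    ((Rn n × ℝ) × ℝ) × Rn n => (v.1.1.2 - v.1.2, v.1.1.1 - v.2))).mul
    (hf.comp (by fun_prop : Measurable fun v : ((Rn n × ℝ) × ℝ) × Rn n => (v.2, v.1.2)))

lemma measurable_heatDuhamel_time_slice (hf : Measurable (Function.uncurry f)) (t : ℝ) :
    Measurable (fun w : Rn n × ℝ => ∫⁻ y, heatKernelENN n (t - w.2) (w.1 - y) * f y w.2) := by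
  refine Measurable.lintegral_prod_right' (f := fun v : (Rn n × ℝ) × Rn n =>
    heatKernelENN n (t - v.1.2) (v.1.1 - v.2) * f v.2 v.1.2) ?_
  exact ((measurable_heatKernelENN n).comp (by fun_prop : Measurable fun v :
    (Rn n × ℝ) × Rn n => (t - v.1.2, v.1.1 - v.2))).mul
    (hf.comp (by fun_prop : Measurable fun v : (Rn n × ℝ) × Rn n => (v.2, v.1.2)))

lemma measurable_heatDuhamel_space_time_slice (hf : Measurable (Function.uncurry f)) (x : Rn n)
    (t : ℝ) : Measurable (fun s : ℝ => ∫⁻ y, heatKernelENN n (t - s) (x - y) * f y s) := by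
  refine Measurable.lintegral_prod_right' (f := fun v : ℝ × Rn n =>
    heatKernelENN n (t - v.1) (x - v.2) * f v.2 v.1) ?_
  exact ((measurable_heatKernelENN n).comp (by fun_prop : Measurable fun v :
    ℝ × Rn n => (t - v.1, x - v.2))).mul
    (hf.comp (by fun_prop : Measurable fun v : ℝ × Rn n => (v.2, v.1)))

lemma measurable_heatDuhamel (hf : Measurable (Function.uncurry f)) :
    Measurable (Function.uncurry (heatDuhamel f)) := by
  have hS : MeasurableSet {w : (Rn n × ℝ) × ℝ | 0 < w.2 ∧ w.2 < w.1.2} :=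
    (measurableSet_lt measurable_const measurable_snd).inter
      (measurableSet_lt measurable_snd measurable_fst.snd)
  have := ((measurable_heatDuhamel_inner hf).indicator hS).lintegral_prod_right' (ν := volume)
  convert this using 2 with z
  simp only [Function.uncurry, heatDuhamel]
  rw [← lintegral_indicator measurableSet_Ioo]
  rfl

lemma heatDuhamel_mono (h : ∀ x s, f x s ≤ g x s) (x : Rn n) (t : ℝ) :
    heatDuhamel f x t ≤ heatDuhamel g x t := by
  refine lintegral_mono fun s => lintegral_mono fun y => ?_
  gcongr
  exact h y s

lemma heatDuhamel_congr_ae {T t : ℝ} (htT : t ≤ T)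
    (h : ∀ᵐ z ∂((volume : Measure (Rn n)).prod (volume.restrict (Ioo 0 T))),
      f z.1 z.2 = g z.1 z.2) (x : Rn n) :
    heatDuhamel f x t = heatDuhamel g x t := by
  have h2 := Measure.ae_ae_of_ae_prod ((Measure.measurePreserving_swap
    (μ := volume.restrict (Ioo 0 T)) (ν := (volume : Measure (Rn n)))).quasiMeasurePreserving.ae h)
  refine lintegral_congr_ae ?_
  filter_upwards [ae_restrict_of_ae_restrict_of_subset (Ioo_subset_Ioo_right htT) h2] with s hs
  refine lintegral_congr_ae (hs.mono fun y hy => ?_)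
  have hy : f y s = g y s := hy
  simp only [hy]

lemma heatDuhamel_const_mul {c : ℝ≥0∞} (hc : c ≠ ⊤) (x : Rn n) (t : ℝ) :
    heatDuhamel (fun y s => c * f y s) x t = c * heatDuhamel f x t := by
  unfold heatDuhamel
  rw [← lintegral_const_mul' _ _ hc]
  refine lintegral_congr fun s => ?_
  rw [← lintegral_const_mul' _ _ hc]
  refine lintegral_congr fun y => ?_
  ring

/-- Monotone convergence for the Duhamel integral. -/
lemma heatDuhamel_iSup {f : ℕ → Rn n → ℝ → ℝ≥0∞} (hf : ∀ j, Measurable (Function.uncurry (f j)))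
    (hmono : ∀ x t, Monotone fun j => f j x t) (x : Rn n) (t : ℝ) :
    heatDuhamel (fun y s => ⨆ j, f j y s) x t = ⨆ j, heatDuhamel (f j) x t := by
  unfold heatDuhamel
  rw [← lintegral_iSup]
  · refine lintegral_congr fun s => ?_
    rw [← lintegral_iSup]
    · simp_rw [ENNReal.mul_iSup]
    · exact fun j => (measurable_heatKernelENN_sub _ x).mul ((hf j).comp measurable_prodMk_right)
    · intro i j hij y
      simp only
      gcongr
      exact hmono y s hij
  · exact fun j => measurable_heatDuhamel_space_time_slice (hf j) x t
  · intro i j hij s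
    refine lintegral_mono fun y => ?_
    gcongr
    exact hmono y s hij

/-- The bound depends on `t` only through the domain of integration, so one exceptional null set of
`x` serves all times. -/
lemma heatDuhamel_le_heatMaximal (f : Rn n → ℝ → ℝ≥0∞) (x : Rn n) (t : ℝ) :
    heatDuhamel f x t ≤ ENNReal.ofReal (2 ^ ((n : ℝ) / 2)) *
      ∫⁻ s in Ioo 0 t, heatMaximal (fun y => f y s) x := by
  unfold heatDuhamel
  rw [← lintegral_const_mul' _ _ ENNReal.ofReal_ne_top]
  exact setLIntegral_mono' measurableSet_Ioo fun s hs =>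
    lintegral_heatKernelENN_mul_le_heatMaximal (sub_pos.2 hs.2) _ x

end Duhamel

/-! ### The mixed norm. -/

section MixedNorm

variable {n : ℕ} {p q k T : ℝ} {F G : Rn n → ℝ → ℝ≥0∞}

lemma measurable_slice_norm (hF : Measurable (Function.uncurry F)) (p r : ℝ) :
    Measurable fun t => (∫⁻ x, F x t ^ p) ^ r :=
  ((hF.pow_const p).lintegral_prod_left' (μ := volume)).pow_const r

lemma mixedNormPow_mono_set {T' : ℝ} (h : T ≤ T') :
    mixedNormPow p q k T F ≤ mixedNormPow p q k T' F :=
  lintegral_mono_set (Ioo_subset_Ioo_right h)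

lemma mixedNormPow_mono (hp : 0 ≤ p) (hq : 0 ≤ q) (h : ∀ x, ∀ t ∈ Ioo 0 T, F x t ≤ G x t) :
    mixedNormPow p q k T F ≤ mixedNormPow p q k T G := by
  refine setLIntegral_mono' measurableSet_Ioo fun t ht => ?_
  gcongr with x
  exact h x t ht

/-- Minkowski in `x`, then convexity of `r ↦ r^q` at each time; a triangle inequality up to a
constant is enough for the fixed-point argument. -/
lemma mixedNormPow_add_le (hp : 1 ≤ p) (hq : 1 ≤ q) (hF : Measurable (Function.uncurry F))
    (hG : Measurable (Function.uncurry G)) :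
    mixedNormPow p q k T (fun x t => F x t + G x t) ≤
      2 ^ (q - 1) * (mixedNormPow p q k T F + mixedNormPow p q k T G) := by
  have hp0 : 0 < p := by linarith
  have hm : Measurable fun t => (∫⁻ x, F x t ^ p) ^ (q / p) * ENNReal.ofReal (t ^ k) :=
    (measurable_slice_norm hF p _).mul (by fun_prop)
  unfold mixedNormPow
  rw [← lintegral_add_left hm, ← lintegral_const_mul' _ _ (by finiteness)]
  refine lintegral_mono fun t => ?_
  have e : ∀ a : ℝ≥0∞, a ^ (q / p) = (a ^ (1 / p)) ^ q := fun a => by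
    rw [← ENNReal.rpow_mul]
    congr 1
    ring
  rw [← add_mul, ← mul_assoc, e, e, e]
  gcongr
  refine le_trans ?_ (ENNReal.rpow_add_le_mul_rpow_add_rpow _ _ hq)
  gcongr
  exact ENNReal.lintegral_Lp_add_le (hF.comp measurable_prodMk_right).aemeasurable
    (hG.comp measurable_prodMk_right).aemeasurable hp

lemma mixedNormPow_iSup (hp : 0 < p) (hq : 0 < q) {F : ℕ → Rn n → ℝ → ℝ≥0∞}
    (hF : ∀ j, Measurable (Function.uncurry (F j))) (hmono : ∀ x t, Monotone fun j => F j x t) :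
    mixedNormPow p q k T (fun x t => ⨆ j, F j x t) = ⨆ j, mixedNormPow p q k T (F j) := by
  have hsup : ∀ {r : ℝ}, 0 < r → ∀ a : ℕ → ℝ≥0∞, (⨆ j, a j) ^ r = ⨆ j, a j ^ r :=
    fun {r} hr a => (ENNReal.orderIsoRpow r hr).map_iSup a
  unfold mixedNormPow
  rw [← lintegral_iSup]
  · refine lintegral_congr fun t => ?_
    simp_rw [hsup hp]
    rw [lintegral_iSup, hsup (by positivity), ENNReal.iSup_mul]
    · exact fun j => ((hF j).comp measurable_prodMk_right).pow_const p
    · intro i j hij x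
      exact ENNReal.rpow_le_rpow (hmono x t hij) hp.le
  · exact fun j => (measurable_slice_norm (hF j) p _).mul (by fun_prop)
  · intro i j hij t
    simp only
    gcongr with x
    exact hmono x t hij

end MixedNorm

/-! ### Norm and pointwise estimates of the Duhamel integral. -/

section Estimates

variable {n : ℕ} {α p q k : ℝ}

/-- The main estimate: the Duhamel integral of `F^α` in the mixed norm. -/
lemma mixedNormPow_heatDuhamel_le (hα : 1 < α) (hk : 0 < k) (hαp : α < p) (hαq : α < q)
    (hκ : k * α / (q - α) < 1)
    (hβ : (n : ℝ) / 2 * ((α - 1) / p) * (q / (q - α)) < 1)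
    (hexp : -1 < k + (q - α) *
      (1 - (n : ℝ) / 2 * ((α - 1) / p) * (q / (q - α)) - k * α / (q - α))) :
    ∃ K e : ℝ, 0 < e ∧ ∀ T, 0 < T → ∀ F : Rn n → ℝ → ℝ≥0∞,
      Measurable (Function.uncurry F) →
      mixedNormPow p q k T (heatDuhamel fun y s => F y s ^ α) ≤
        ENNReal.ofReal (K * T ^ e) * mixedNormPow p q k T F ^ α := by
  have hα0 : 0 < α := by linarith
  have hp0 : 0 < p := by linarith
  have hq0 : 0 < q := by linarith
  have hqα : 0 < q - α := by linarith
  have hb : 1 < p / α := (one_lt_div hα0).2 hαp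
  set γ := (n : ℝ) / 2 * ((α - 1) / p) with hγdef
  have hγ : 0 ≤ γ := mul_nonneg (by positivity) (div_nonneg (by linarith) hp0.le)
  obtain ⟨C, hC, hholder⟩ := setLIntegral_time_holder hα0 hαq hk.le hκ hγ hβ
  set σ := 1 - γ * (q / (q - α)) - k * α / (q - α) with hσ
  -- These come from integrating `t^{k+(q-α)σ}` over `(0,T)`; `hexp` is precisely the integrability
  -- at `0`.
  refine ⟨C ^ (q - α) / (k + (q - α) * σ + 1), k + (q - α) * σ + 1, by linarith,
    fun T hT F hF => ?_⟩
  set A := mixedNormPow p q k T F with hA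
  -- pointwise in time
  have hpt : ∀ t ∈ Ioo 0 T, (∫⁻ x, heatDuhamel (fun y s => F y s ^ α) x t ^ p) ^ (q / p) ≤
      ENNReal.ofReal (C * t ^ σ) ^ (q - α) * A ^ α := by
    intro t ht
    have hm := measurable_slice_norm hF p (1 / p)
    have hmink := lintegral_lintegral_rpow_le (μ := (volume : Measure (Rn n)))
      (ν := volume.restrict (Ioo 0 t)) (p := p) (by linarith)
      (F := fun x s => ∫⁻ y, heatKernelENN n (t - s) (x - y) * F y s ^ α)
      (measurable_heatDuhamel_time_slice (f := fun y s => F y s ^ α) (hF.pow_const α) t)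
      (a := fun s => ENNReal.ofReal ((t - s) ^ (-γ)) * ((∫⁻ x, F x s ^ p) ^ (1 / p)) ^ α)
      (by fun_prop) (by
        rw [ae_restrict_iff' measurableSet_Ioo]
        refine ae_of_all _ fun s hs => ?_
        have hts : 0 < t - s := sub_pos.2 hs.2
        have hFs : Measurable fun y => F y s ^ α :=
          (hF.comp measurable_prodMk_right).pow_const α
        refine (lintegral_heat_rpow_le hts hb (div_le_self hp0.le hα.le) hFs).trans ?_
        rw [ENNReal.mul_rpow_of_nonneg _ _ hp0.le]
        gcongr ?_ * ?_
        · rw [ENNReal.ofReal_rpow_of_nonneg (by positivity)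
            (div_nonneg (by linarith [div_le_self hp0.le hα.le]) (by positivity)),
            ENNReal.ofReal_rpow_of_nonneg (by positivity) hp0.le, ← Real.rpow_mul (by positivity),
            ← Real.rpow_mul hts.le]
          refine ENNReal.ofReal_le_ofReal ?_
          -- Smoothing from `b = p/α`, where `(p-b)/b = α-1`; the factor `4π ≥ 1` is then discarded.
          have e : -(n : ℝ) / 2 * ((p - p / α) / (p / α)) = -γ * p := by
            rw [hγdef]
            field_simp
          rw [e]
          refine Real.rpow_le_rpow_of_nonpos hts ?_ (by nlinarith)
          have : 1 ≤ 4 * Real.pi := by linarith [Real.pi_gt_three]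
          nlinarith
        · rw [← ENNReal.rpow_mul, ← ENNReal.rpow_mul]
          simp_rw [← ENNReal.rpow_mul]
          refine le_of_eq ?_
          rw [mul_div_cancel₀ _ hα0.ne']
          congr 1
          field_simp)
    have hh := hholder t ht.1 _ hm
    calc (∫⁻ x, heatDuhamel (fun y s => F y s ^ α) x t ^ p) ^ (q / p)
        ≤ ((ENNReal.ofReal (C * t ^ σ) ^ ((q - α) / q) * A ^ (α / q)) ^ p) ^ (q / p) := by
          gcongr
          refine hmink.trans ?_
          gcongr
          refine hh.trans ?_
          gcongr
          rw [hA]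
          refine le_trans (le_of_eq ?_) (mixedNormPow_mono_set ht.2.le)
          unfold mixedNormPow
          refine lintegral_congr fun s => ?_
          rw [← ENNReal.rpow_mul]
          congr 2
          ring
      _ = _ := by
          rw [← ENNReal.rpow_mul, mul_div_cancel₀ _ hp0.ne', ENNReal.mul_rpow_of_nonneg _ _ hq0.le,
            ← ENNReal.rpow_mul, ← ENNReal.rpow_mul, div_mul_cancel₀ _ hq0.ne',
            div_mul_cancel₀ _ hq0.ne']
  calc mixedNormPow p q k T (heatDuhamel fun y s => F y s ^ α)
      ≤ ∫⁻ t in Ioo 0 T, ENNReal.ofReal (C ^ (q - α)) * A ^ α *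
          ENNReal.ofReal (t ^ (-(-(k + (q - α) * σ)))) := by
        refine setLIntegral_mono' measurableSet_Ioo fun t ht => ?_
        have ht0 : 0 < t := ht.1
        refine (mul_le_mul_left (hpt t ht) _).trans_eq ?_
        rw [ENNReal.ofReal_rpow_of_nonneg (by positivity) hqα.le, mul_right_comm,
          mul_right_comm (ENNReal.ofReal (C ^ (q - α))),
          ← ENNReal.ofReal_mul (by positivity), ← ENNReal.ofReal_mul (by positivity),
          Real.mul_rpow hC.le (by positivity), ← Real.rpow_mul ht0.le, mul_assoc,
          ← Real.rpow_add ht0]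
        congr 4
        ring
    _ = ENNReal.ofReal (C ^ (q - α)) * A ^ α *
          ENNReal.ofReal (T ^ (1 - -(k + (q - α) * σ)) / (1 - -(k + (q - α) * σ))) := by
        rw [lintegral_const_mul _ (by fun_prop), setLIntegral_rpow_neg (by linarith) hT.le]
    _ = _ := by
        rw [mul_right_comm, ← ENNReal.ofReal_mul (by positivity)]
        congr 2
        rw [show 1 - -(k + (q - α) * σ) = k + (q - α) * σ + 1 by ring]
        ring

/-- At almost every point the Duhamel integral is finite at all times and tends to `0`. -/
lemma ae_heatDuhamel_lt_top_and_tendsto (hα : 1 < α) (hk : 0 < k) (hαp : α < p) (hαq : α < q)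
    (hκ : k * α / (q - α) < 1) {T : ℝ} (hT : 0 < T) {F : Rn n → ℝ → ℝ≥0∞}
    (hF : Measurable (Function.uncurry F)) (hfin : mixedNormPow p q k T F ≠ ⊤) :
    ∀ᵐ x : Rn n, (∀ t ∈ Ioo 0 T, heatDuhamel (fun y s => F y s ^ α) x t < ⊤) ∧
      Tendsto (fun t => heatDuhamel (fun y s => F y s ^ α) x t) (𝓝[>] 0) (𝓝 0) := by
  have hα0 : 0 < α := by linarith
  have hp0 : 0 < p := by linarith
  have hq0 : 0 < q := by linarith
  have hqα : 0 < q - α := by linarith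
  have hb : 1 < p / α := (one_lt_div hα0).2 hαp
  -- With no kernel singularity, Hölder in time puts `F^α` in `L^1((0,T); L^{p/α})`, as the maximal
  -- estimate requires.
  obtain ⟨C, hC, hholder⟩ := setLIntegral_time_holder (γ := 0) hα0 hαq hk.le hκ le_rfl (by simp)
  have hh := hholder T hT _ (measurable_slice_norm hF p (1 / p))
  have hL1 : ∫⁻ s in Ioo 0 T, (∫⁻ y, (F y s ^ α) ^ (p / α)) ^ (1 / (p / α)) ≠ ⊤ := by
    refine ne_top_of_le_ne_top ?_ (le_trans (le_of_eq ?_) hh)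
    · refine ENNReal.mul_ne_top (ENNReal.rpow_ne_top_of_nonneg (by positivity)
        ENNReal.ofReal_ne_top) (ENNReal.rpow_ne_top_of_nonneg (by positivity) ?_)
      convert hfin using 1
      refine lintegral_congr fun s => ?_
      rw [← ENNReal.rpow_mul]
      congr 2
      ring
    · refine lintegral_congr fun s => ?_
      rw [neg_zero, Real.rpow_zero, ENNReal.ofReal_one, one_mul, ← ENNReal.rpow_mul]
      simp_rw [← ENNReal.rpow_mul]
      rw [mul_div_cancel₀ _ hα0.ne']
      congr 1
      field_simp
  filter_upwards [ae_lintegral_heatMaximal_ne_top hb (f := fun y s => F y s ^ α)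
    (hF.pow_const α) hL1] with x hx
  constructor
  · intro t ht
    refine (heatDuhamel_le_heatMaximal _ x t).trans_lt ?_
    refine ENNReal.mul_lt_top ENNReal.ofReal_lt_top ?_
    exact (lintegral_mono_set (Ioo_subset_Ioo_right ht.2.le)).trans_lt hx.lt_top
  -- Absolute continuity of the finite integral of the maximal function.
  · have hs : Tendsto ((volume.restrict (Ioo 0 T)) ∘ fun t : ℝ => Ioo 0 t) (𝓝[>] 0) (𝓝 0) := by
      have h1 : Tendsto (fun t : ℝ => ENNReal.ofReal t) (𝓝[>] 0) (𝓝 0) := by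
        have := (ENNReal.continuous_ofReal.tendsto 0).mono_left
          (nhdsWithin_le_nhds (s := Ioi (0 : ℝ)))
        rwa [ENNReal.ofReal_zero] at this
      refine tendsto_of_tendsto_of_tendsto_of_le_of_le tendsto_const_nhds h1
        (fun _ => bot_le) fun t => ?_
      refine (Measure.restrict_apply_le _ _).trans_eq ?_
      rw [Real.volume_Ioo, sub_zero]
    have h0 := ENNReal.Tendsto.const_mul (a := ENNReal.ofReal (2 ^ ((n : ℝ) / 2)))
      (tendsto_setLIntegral_zero hx hs) (Or.inr ENNReal.ofReal_ne_top)
    rw [mul_zero] at h0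
    refine tendsto_of_tendsto_of_tendsto_of_le_of_le' tendsto_const_nhds h0
      (Eventually.of_forall fun _ => bot_le) ?_
    filter_upwards [Ioo_mem_nhdsGT hT] with t ht
    refine (heatDuhamel_le_heatMaximal _ x t).trans (le_of_eq ?_)
    rw [Measure.restrict_restrict measurableSet_Ioo, inter_eq_left.2
      (Ioo_subset_Ioo_right ht.2.le)]

end Estimates

/-! ### Monotone Picard iteration. -/

/-- Picard iteration, started at `0`, for the equation `z = H + ∫ heat kernel * G(z)`. -/
noncomputable def picardENN {n : ℕ} (H : Rn n → ℝ → ℝ≥0∞) (G : Rn n → ℝ → ℝ≥0∞ → ℝ≥0∞) :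
    ℕ → Rn n → ℝ → ℝ≥0∞
  | 0 => fun _ _ => 0
  | j + 1 => fun x t => H x t + heatDuhamel (fun y s => G y s (picardENN H G j y s)) x t

section Picard

variable {n : ℕ} {H : Rn n → ℝ → ℝ≥0∞} {G : Rn n → ℝ → ℝ≥0∞ → ℝ≥0∞}

lemma measurable_picardENN (hH : Measurable (Function.uncurry H))
    (hG : Measurable fun z : (Rn n × ℝ) × ℝ≥0∞ => G z.1.1 z.1.2 z.2) (j : ℕ) :
    Measurable (Function.uncurry (picardENN H G j)) := by
  induction j with
  | zero => exact measurable_const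
  | succ j ih =>
    exact hH.add (measurable_heatDuhamel (f := fun y s => G y s (picardENN H G j y s))
      (hG.comp (measurable_id.prodMk ih)))

lemma monotone_picardENN (hmono : ∀ y s, Monotone (G y s)) (x : Rn n) (t : ℝ) :
    Monotone fun j => picardENN H G j x t := by
  suffices h : ∀ j x t, picardENN H G j x t ≤ picardENN H G (j + 1) x t from
    monotone_nat_of_le_succ fun j => h j x t
  intro j
  induction j with
  | zero => exact fun x t => zero_le
  | succ j ih =>
    intro x t
    change H x t + _ ≤ H x t + _
    gcongr 1
    exact heatDuhamel_mono (fun y s => hmono y s (ih y s)) x t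

/-- Monotone convergence. Continuity of `G` is needed only almost everywhere, since Duhamel
integrals ignore null sets; the equation still holds at every `x` and every `t ≤ T`. -/
lemma iSup_picardENN_eq (hH : Measurable (Function.uncurry H))
    (hG : Measurable fun z : (Rn n × ℝ) × ℝ≥0∞ => G z.1.1 z.1.2 z.2)
    (hmono : ∀ y s, Monotone (G y s)) {T t : ℝ} (htT : t ≤ T)
    (hcont : ∀ᵐ z ∂((volume : Measure (Rn n)).prod (volume.restrict (Ioo 0 T))),
      ∀ a : ℕ → ℝ≥0∞, Monotone a → ⨆ j, G z.1 z.2 (a j) = G z.1 z.2 (⨆ j, a j)) (x : Rn n) :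
    ⨆ j, picardENN H G j x t =
      H x t + heatDuhamel (fun y s => G y s (⨆ j, picardENN H G j y s)) x t := by
  have hm := measurable_picardENN hH hG
  have hmon := monotone_picardENN (H := H) hmono
  rw [← (hmon x t).iSup_nat_add 1]
  change ⨆ j, (H x t + heatDuhamel (fun y s => G y s (picardENN H G j y s)) x t) = _
  rw [← ENNReal.add_iSup, ← heatDuhamel_iSup (f := fun j y s => G y s (picardENN H G j y s))
    (fun j => hG.comp (measurable_id.prodMk (hm j)))
    (fun y s i j hij => hmono y s (hmon y s hij))]
  congr 1
  exact heatDuhamel_congr_ae htT (hcont.mono fun z hz => hz _ (hmon z.1 z.2)) x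

end Picard

/-! ### The majorant and the signed solution. -/

section Existence

variable {n : ℕ} {α p q k : ℝ}

/-- A nonnegative solution with finite norm, on a short time interval. -/
lemma exists_majorant (hα : 1 < α) (hk : 0 < k) (hαp : α < p) (hαq : α < q)
    (hκ : k * α / (q - α) < 1)
    (hβ : (n : ℝ) / 2 * ((α - 1) / p) * (q / (q - α)) < 1)
    (hexp : -1 < k + (q - α) *
      (1 - (n : ℝ) / 2 * ((α - 1) / p) * (q / (q - α)) - k * α / (q - α)))
    {T₀ : ℝ} (hT₀ : 0 < T₀) {h : Rn n → ℝ → ℝ≥0∞} (hh : Measurable (Function.uncurry h))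
    (hfin : mixedNormPow p q k T₀ h ≠ ⊤) :
    ∃ T, 0 < T ∧ T ≤ T₀ ∧ ∃ w : Rn n → ℝ → ℝ≥0∞, Measurable (Function.uncurry w) ∧
      mixedNormPow p q k T w ≠ ⊤ ∧
      ∀ x t, w x t = h x t + heatDuhamel (fun y s => w y s ^ α) x t := by
  have hα0 : 0 < α := by linarith
  have hp0 : 0 < p := by linarith
  have hq0 : 0 < q := by linarith
  obtain ⟨K, e, he, hest⟩ := mixedNormPow_heatDuhamel_le hα hk hαp hαq hκ hβ hexp
  set D : ℝ≥0∞ := 2 ^ (q - 1) with hD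
  have hDt : D ≠ ⊤ := by finiteness
  -- The bound preserved by the iteration: `D = 2^{q-1}` comes from `mixedNormPow_add_le`, and `T`
  -- is chosen to make the nonlinear contribution at most `1`.
  set M := D * mixedNormPow p q k T₀ h + 1 with hM
  have hMt : M ≠ ⊤ := by finiteness
  have hlim : Tendsto (fun T : ℝ => D * (ENNReal.ofReal (K * T ^ e) * M ^ α)) (𝓝[>] 0)
      (𝓝 0) := by
    have h1 : Tendsto (fun T : ℝ => K * T ^ e) (𝓝[>] 0) (𝓝 (K * 0 ^ e)) :=
      ((Real.continuousAt_rpow_const 0 e (Or.inr he.le)).tendsto.mono_left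
        nhdsWithin_le_nhds).const_mul K
    rw [Real.zero_rpow he.ne', mul_zero] at h1
    have h2 := ENNReal.Tendsto.const_mul (ENNReal.Tendsto.mul_const (ENNReal.tendsto_ofReal h1)
      (Or.inr (show M ^ α ≠ ⊤ by finiteness))) (Or.inr hDt)
    rwa [ENNReal.ofReal_zero, zero_mul, mul_zero] at h2
  obtain ⟨T, hT1, hT2⟩ := ((hlim.eventually (ge_mem_nhds zero_lt_one)).and
    (Ioc_mem_nhdsGT hT₀)).exists
  have hGm : Measurable fun z : (Rn n × ℝ) × ℝ≥0∞ => z.2 ^ α := by fun_prop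
  have hmono : ∀ (y : Rn n) (s : ℝ), Monotone fun r : ℝ≥0∞ => r ^ α :=
    fun y s => ENNReal.monotone_rpow_of_nonneg hα0.le
  have hm := measurable_picardENN (G := fun _ _ r => r ^ α) hh hGm
  have hmon := monotone_picardENN (H := h) (G := fun _ _ r => r ^ α) hmono
  refine ⟨T, hT2.1, hT2.2, fun x t => ⨆ j, picardENN h (fun _ _ r => r ^ α) j x t,
    Measurable.iSup hm, ?_, fun x t => ?_⟩
  · rw [mixedNormPow_iSup hp0 hq0 hm hmon]
    refine ne_top_of_le_ne_top hMt (iSup_le fun j => ?_)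
    induction j with
    | zero =>
      refine le_trans (le_of_eq ?_) zero_le
      have : 0 < q / p := by positivity
      simp [mixedNormPow, picardENN, hp0, this]
    | succ j ih =>
      refine (mixedNormPow_add_le (by linarith) (by linarith) hh
        (measurable_heatDuhamel (f := fun y s => picardENN h (fun _ _ r => r ^ α) j y s ^ α)
          ((hm j).pow_const α))).trans ?_
      rw [mul_add]
      refine add_le_add ?_ ?_
      · gcongr
        exact mixedNormPow_mono_set hT2.2
      · refine le_trans ?_ hT1
        gcongr
        refine (hest T hT2.1 _ (hm j)).trans ?_
        gcongr
  · refine iSup_picardENN_eq hh hGm hmono le_rfl (ae_of_all _ fun z a ha => ?_) x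
    exact ((ENNReal.orderIsoRpow α hα0).map_iSup a).symm

/-- The nonlinearity `r ↦ |r|^(α-1) r`, recentred at `-w` and shifted to be nonnegative. -/
noncomputable def shiftedPower (α : ℝ) (w r : ℝ≥0∞) : ℝ≥0∞ :=
  (r - w) ^ α + (w ^ α - (w - r) ^ α)

/-- Truncated subtraction annihilates one of `r - w` and `w - r`, so for finite arguments
`shiftedPower` is `N(r - w) + w^α`. Its monotonicity makes the iteration available for signed
solutions. -/
lemma monotone_shiftedPower (hα : 0 ≤ α) (w : ℝ≥0∞) : Monotone (shiftedPower α w) := by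
  intro a b hab
  unfold shiftedPower
  gcongr

/-- Makes `2w` a supersolution, since `2w = 2|h| + D(2 w^α)`. -/
lemma shiftedPower_le (hα : 0 ≤ α) {w r : ℝ≥0∞} (h : r ≤ 2 * w) :
    shiftedPower α w r ≤ 2 * w ^ α := by
  rw [two_mul] at h ⊢
  refine add_le_add ?_ tsub_le_self
  gcongr
  exact tsub_le_iff_right.2 h

lemma iSup_shiftedPower (hα : 0 ≤ α) {w : ℝ≥0∞} (hw : w ≠ ⊤) {a : ℕ → ℝ≥0∞}
    (ha : Monotone a) : ⨆ j, shiftedPower α w (a j) = shiftedPower α w (⨆ j, a j) := by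
  have hc : Continuous (shiftedPower α w) := by
    unfold shiftedPower
    have hwα : w ^ α ≠ ⊤ := by finiteness
    exact (ENNReal.continuous_rpow_const.comp (ENNReal.continuous_sub_right w)).add
      ((ENNReal.continuous_sub_left hwα).comp
        (ENNReal.continuous_rpow_const.comp (ENNReal.continuous_sub_left hw)))
  exact tendsto_nhds_unique (tendsto_atTop_iSup ((monotone_shiftedPower hα w).comp ha))
    ((hc.tendsto _).comp (tendsto_atTop_iSup ha))

lemma measurable_shiftedPower {w : Rn n → ℝ → ℝ≥0∞} (hw : Measurable (Function.uncurry w)) :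
    Measurable fun z : (Rn n × ℝ) × ℝ≥0∞ => shiftedPower α (w z.1.1 z.1.2) z.2 := by
  have hw' : Measurable fun z : (Rn n × ℝ) × ℝ≥0∞ => w z.1.1 z.1.2 := hw.comp measurable_fst
  exact ((measurable_snd.sub hw').pow_const α).add
    ((hw'.pow_const α).sub ((hw'.sub measurable_snd).pow_const α))

lemma powerNL_sub_eq (hα : 0 < α) {w z : ℝ≥0∞} (hw : w ≠ ⊤) (hz : z ≠ ⊤) :
    powerNL α (z.toReal - w.toReal) = (shiftedPower α w z).toReal - (w ^ α).toReal := by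
  have key : ∀ r : ℝ, 0 ≤ r → r ^ (α - 1) * r = r ^ α := fun r hr => by
    nth_rw 2 [← Real.rpow_one r]
    rw [← Real.rpow_add' hr (by simpa using hα.ne'), sub_add_cancel]
  unfold powerNL shiftedPower
  rcases le_total w z with h | h
  · have h' := ENNReal.toReal_mono hz h
    rw [tsub_eq_zero_of_le h, ENNReal.zero_rpow_of_pos hα, tsub_zero,
      ENNReal.toReal_add (by finiteness) (by finiteness), ← ENNReal.toReal_rpow,
      ENNReal.toReal_sub_of_le h hz, abs_of_nonneg (sub_nonneg.2 h'),
      key _ (sub_nonneg.2 h'), add_sub_cancel_right]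
  · have h' := ENNReal.toReal_mono hw h
    rw [tsub_eq_zero_of_le h, ENNReal.zero_rpow_of_pos hα, zero_add,
      ENNReal.toReal_sub_of_le (by gcongr; exact tsub_le_self) (by finiteness),
      ← ENNReal.toReal_rpow (w - z), ENNReal.toReal_sub_of_le h hw, abs_sub_comm,
      abs_of_nonneg (sub_nonneg.2 h'), ← key _ (sub_nonneg.2 h')]
    ring

lemma heatDuhamel_eq_lintegral_prod {f : Rn n → ℝ → ℝ≥0∞} (hf : Measurable (Function.uncurry f))
    (x : Rn n) (t : ℝ) : heatDuhamel f x t = ∫⁻ z : ℝ × Rn n,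
      heatKernelENN n (t - z.1) (x - z.2) * f z.2 z.1 ∂((volume.restrict (Ioo 0 t)).prod volume) := by
  rw [lintegral_prod]
  · rfl
  · exact (((measurable_heatKernelENN n).comp (by fun_prop : Measurable fun v :
      ℝ × Rn n => (t - v.1, x - v.2))).mul
      (hf.comp (by fun_prop : Measurable fun v : ℝ × Rn n => (v.2, v.1)))).aemeasurable

lemma ae_mem_Ioo_prod (t : ℝ) :
    ∀ᵐ z : ℝ × Rn n ∂((volume.restrict (Ioo 0 t)).prod volume), z.1 ∈ Ioo 0 t :=
  Measure.quasiMeasurePreserving_fst.ae (ae_restrict_mem measurableSet_Ioo)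

/-- The Duhamel integral of a difference, as a Bochner integral. -/
lemma integrable_and_integral_heatKernel_mul {f g : Rn n → ℝ → ℝ≥0∞} {φ : Rn n → ℝ → ℝ}
    (hf : Measurable (Function.uncurry f)) (hg : Measurable (Function.uncurry g)) {x : Rn n}
    {t : ℝ} (hft : heatDuhamel f x t ≠ ⊤) (hgt : heatDuhamel g x t ≠ ⊤)
    (hφ : ∀ᵐ z : ℝ × Rn n ∂((volume.restrict (Ioo 0 t)).prod volume),
      φ z.2 z.1 = (f z.2 z.1).toReal - (g z.2 z.1).toReal) :
    Integrable (fun z : ℝ × Rn n => heatKernel n (t - z.1) (x - z.2) * φ z.2 z.1)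
      ((volume.restrict (Ioo 0 t)).prod volume) ∧
    ∫ s in Ioo 0 t, ∫ y, heatKernel n (t - s) (x - y) * φ y s =
      (heatDuhamel f x t).toReal - (heatDuhamel g x t).toReal := by
  set μ := (volume.restrict (Ioo 0 t)).prod (volume : Measure (Rn n)) with hμ
  have hmeas : ∀ {f : Rn n → ℝ → ℝ≥0∞}, Measurable (Function.uncurry f) →
      Measurable fun z : ℝ × Rn n => heatKernelENN n (t - z.1) (x - z.2) * f z.2 z.1 :=
    fun hf => ((measurable_heatKernelENN n).comp (by fun_prop : Measurable fun v :
      ℝ × Rn n => (t - v.1, x - v.2))).mul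
      (hf.comp (by fun_prop : Measurable fun v : ℝ × Rn n => (v.2, v.1)))
  rw [heatDuhamel_eq_lintegral_prod hf] at hft ⊢
  rw [heatDuhamel_eq_lintegral_prod hg] at hgt ⊢
  have if1 := integrable_toReal_of_lintegral_ne_top (hmeas hf).aemeasurable hft
  have ig1 := integrable_toReal_of_lintegral_ne_top (hmeas hg).aemeasurable hgt
  have hae : (fun z : ℝ × Rn n => (heatKernelENN n (t - z.1) (x - z.2) * f z.2 z.1).toReal -
      (heatKernelENN n (t - z.1) (x - z.2) * g z.2 z.1).toReal) =ᵐ[μ]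
      fun z => heatKernel n (t - z.1) (x - z.2) * φ z.2 z.1 := by
    filter_upwards [hφ, ae_mem_Ioo_prod (n := n) t] with z hz hzt
    rw [hz, ENNReal.toReal_mul, ENNReal.toReal_mul, heatKernelENN,
      ENNReal.toReal_ofReal (heatKernel_nonneg n (sub_nonneg.2 hzt.2.le) _)]
    ring
  have hI := (if1.sub ig1).congr hae
  refine ⟨hI, ?_⟩
  rw [integral_integral (f := fun s y => heatKernel n (t - s) (x - y) * φ y s) hI,
    ← integral_congr_ae hae, integral_sub if1 ig1,
    integral_toReal (hmeas hf).aemeasurable (ae_lt_top (hmeas hf) hft),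
    integral_toReal (hmeas hg).aemeasurable (ae_lt_top (hmeas hg) hgt)]

/-- Local existence of a signed solution of the integral equation, dominated by `w`. -/
lemma exists_signed_solution (hα : 1 < α) {T : ℝ} {h : Rn n → ℝ → ℝ}
    (hh : Measurable (Function.uncurry h)) {w : Rn n → ℝ → ℝ≥0∞}
    (hw : Measurable (Function.uncurry w))
    (hweq : ∀ x t, w x t = ‖h x t‖ₑ + heatDuhamel (fun y s => w y s ^ α) x t)
    (hfin : ∀ᵐ x : Rn n, ∀ t ∈ Ioo 0 T, heatDuhamel (fun y s => w y s ^ α) x t < ⊤) :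
    ∃ u : Rn n → ℝ → ℝ, Measurable (Function.uncurry u) ∧ (∀ x t, ‖u x t‖ₑ ≤ w x t) ∧
      ∀ᵐ x : Rn n, ∀ t ∈ Ioo 0 T,
        Integrable (fun z : ℝ × Rn n => heatKernel n (t - z.1) (x - z.2) * powerNL α (u z.2 z.1))
          ((volume.restrict (Ioo 0 t)).prod volume) ∧
        u x t = h x t + ∫ s in Ioo 0 t, ∫ y, heatKernel n (t - s) (x - y) * powerNL α (u y s) := by
  have hα0 : 0 < α := by linarith
  -- Data of the equation for `z = u + w`, obtained by adding the equations of `u` and `w`.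
  set H : Rn n → ℝ → ℝ≥0∞ := fun x t => ENNReal.ofReal (h x t + |h x t|) with hHdef
  set G : Rn n → ℝ → ℝ≥0∞ → ℝ≥0∞ := fun y s r => shiftedPower α (w y s) r with hGdef
  have hH : Measurable (Function.uncurry H) := by
    have : Measurable fun z : Rn n × ℝ => ENNReal.ofReal
        (Function.uncurry h z + |Function.uncurry h z|) := by fun_prop
    exact this
  have hGm : Measurable fun z : (Rn n × ℝ) × ℝ≥0∞ => G z.1.1 z.1.2 z.2 := measurable_shiftedPower hw
  have hGmono : ∀ y s, Monotone (G y s) := fun y s => monotone_shiftedPower hα0.le _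
  have hH2 : ∀ x t, H x t ≤ 2 * ‖h x t‖ₑ := fun x t => by
    rw [hHdef, Real.enorm_eq_ofReal_abs, ← ENNReal.ofReal_ofNat, ← ENNReal.ofReal_mul two_pos.le]
    refine ENNReal.ofReal_le_ofReal ?_
    linarith [le_abs_self (h x t)]
  have hwfin : ∀ᵐ x : Rn n, ∀ t ∈ Ioo 0 T, w x t ≠ ⊤ := hfin.mono fun x hx t ht => by
    rw [hweq]
    exact ENNReal.add_ne_top.2 ⟨enorm_ne_top, (hx t ht).ne⟩
  have hwfin2 : ∀ᵐ z ∂((volume : Measure (Rn n)).prod (volume.restrict (Ioo 0 T))),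
      w z.1 z.2 ≠ ⊤ := by
    have hms : MeasurableSet {z : Rn n × ℝ | w z.1 z.2 ≠ ⊤} :=
      (hw (measurableSet_singleton ⊤)).compl
    rw [Measure.ae_prod_iff_ae_ae hms]
    filter_upwards [hwfin] with x hx
    rw [ae_restrict_iff' measurableSet_Ioo]
    exact ae_of_all _ hx
  set z : Rn n → ℝ → ℝ≥0∞ := fun x t => ⨆ j, picardENN H G j x t with hzdef
  have hzm : Measurable (Function.uncurry z) := Measurable.iSup (measurable_picardENN hH hGm)
  have hz2 : ∀ x t, z x t ≤ 2 * w x t := by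
    suffices ∀ j x t, picardENN H G j x t ≤ 2 * w x t from fun x t => iSup_le fun j => this j x t
    intro j
    induction j with
    | zero => exact fun x t => zero_le
    | succ j ih =>
      intro x t
      rw [hweq x t, mul_add, ← heatDuhamel_const_mul ENNReal.ofNat_ne_top]
      exact add_le_add (hH2 x t)
        (heatDuhamel_mono (fun y s => shiftedPower_le hα0.le (ih y s)) x t)
  have hzeq : ∀ x, ∀ t ≤ T, z x t = H x t + heatDuhamel (fun y s => G y s (z y s)) x t :=
    fun x t ht => iSup_picardENN_eq hH hGm hGmono ht
      (hwfin2.mono fun y hy a ha => iSup_shiftedPower hα0.le hy ha) x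
  have hzfin : ∀ {x t}, w x t ≠ ⊤ → z x t ≠ ⊤ := fun {x t} hx =>
    ne_top_of_le_ne_top (ENNReal.mul_ne_top ENNReal.ofNat_ne_top hx) (hz2 x t)
  have hGz : Measurable (Function.uncurry fun y s => G y s (z y s)) :=
    hGm.comp (measurable_id.prodMk hzm)
  have hwα : Measurable (Function.uncurry fun y s => w y s ^ α) := hw.pow_const α
  refine ⟨fun x t => (z x t).toReal - (w x t).toReal, hzm.ennreal_toReal.sub hw.ennreal_toReal,
    fun x t => ?_, ?_⟩
  · rcases eq_or_ne (w x t) ⊤ with htop | htop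
    · rw [htop]
      exact le_top
    · rw [Real.enorm_eq_ofReal_abs]
      refine ENNReal.ofReal_le_of_le_toReal (abs_le.2 ⟨?_, ?_⟩)
      · linarith [ENNReal.toReal_nonneg (a := z x t)]
      · have := ENNReal.toReal_mono (ENNReal.mul_ne_top ENNReal.ofNat_ne_top htop) (hz2 x t)
        rw [ENNReal.toReal_mul, ENNReal.toReal_ofNat] at this
        linarith
  · filter_upwards [hfin, hwfin] with x hx hx2 t ht
    have hDz : heatDuhamel (fun y s => G y s (z y s)) x t ≠ ⊤ := by
      refine ne_top_of_le_ne_top (hzfin (hx2 t ht)) ?_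
      rw [hzeq x t ht.2.le]
      exact le_add_self
    obtain ⟨hint, heq⟩ := integrable_and_integral_heatKernel_mul
      (φ := fun y s => powerNL α ((z y s).toReal - (w y s).toReal)) hGz hwα hDz (hx t ht).ne (by
        have h2 : ∀ᵐ v ∂((volume.restrict (Ioo 0 T)).prod (volume : Measure (Rn n))),
            w v.2 v.1 ≠ ⊤ := Measure.measurePreserving_swap.quasiMeasurePreserving.ae hwfin2
        have hac : (volume.restrict (Ioo 0 t)).prod (volume : Measure (Rn n)) ≤
            (volume.restrict (Ioo 0 T)).prod (volume : Measure (Rn n)) :=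
          Measure.prod_mono (Measure.restrict_mono_set _ (Ioo_subset_Ioo_right ht.2.le)) le_rfl
        filter_upwards [ae_mono hac h2] with v hv
        exact powerNL_sub_eq hα0 hv (hzfin hv))
    refine ⟨hint, ?_⟩
    rw [heq, hzeq x t ht.2.le, hweq x t, ENNReal.toReal_add ENNReal.ofReal_ne_top hDz,
      ENNReal.toReal_add enorm_ne_top (hx t ht).ne,
      ENNReal.toReal_ofReal (by linarith [neg_abs_le (h x t)]), toReal_enorm, Real.norm_eq_abs]
    ring

end Existence

/-! ### The mixed norm and `MemX`. -/

section MemX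

variable {n : ℕ} {p q k T : ℝ}

lemma memX_lintegral_eq (hp : 0 < p) (F : Rn n → ℝ → ℝ) :
    ∫⁻ t in Ioo 0 T, eLpNorm (fun x => F x t) (ENNReal.ofReal p) volume ^ q *
      ENNReal.ofReal (t ^ k) = mixedNormPow p q k T fun x t => ‖F x t‖ₑ := by
  unfold mixedNormPow
  refine lintegral_congr fun t => ?_
  rw [eLpNorm_eq_lintegral_rpow_enorm_toReal (by simpa using hp) ENNReal.ofReal_ne_top,
    ENNReal.toReal_ofReal hp.le, ← ENNReal.rpow_mul]
  congr 2
  ring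

lemma mixedNormPow_congr_ae {F G : Rn n → ℝ → ℝ≥0∞}
    (h : ∀ᵐ z ∂((volume : Measure (Rn n)).prod (volume.restrict (Ioo 0 T))),
      F z.1 z.2 = G z.1 z.2) : mixedNormPow p q k T F = mixedNormPow p q k T G := by
  have h2 := Measure.ae_ae_of_ae_prod ((Measure.measurePreserving_swap
    (μ := volume.restrict (Ioo 0 T)) (ν := (volume : Measure (Rn n)))).quasiMeasurePreserving.ae h)
  refine lintegral_congr_ae ?_
  filter_upwards [h2] with s hs
  have : ∫⁻ x, F x s ^ p = ∫⁻ x, G x s ^ p := by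
    refine lintegral_congr_ae (hs.mono fun y hy => ?_)
    have hy : F y s = G y s := hy
    simp only [hy]
  simp only [this]

end MemX

/-! ### Weighted initial data. -/

section InitialData

variable {n : ℕ} {p : ℝ} {U v : Rn n → ℝ}

lemma MemWeightedLp.aestronglyMeasurable (hv : IsWeight v) (hU : MemWeightedLp p v U) :
    AEStronglyMeasurable U := by
  refine hU.1.mono_ac (withDensity_absolutelyContinuous' hv.measurable.ennreal_ofReal.aemeasurable
    (ae_of_all _ fun x => ?_))
  simpa using hv.pos x

/-- Data in `L^p_v` with `v ∈ D_p` have a heat extension for small times. -/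
lemma exists_integrable_heatKernel_mul (hp : 1 < p) (hv : WeightClassD p v)
    (hU : MemWeightedLp p v U) :
    ∃ t₁ > 0, ∀ t ∈ Ioc 0 t₁, ∀ x, Integrable fun y => heatKernel n t (x - y) * U y := by
  obtain ⟨hw, t₀, ht₀, x₀, hmem⟩ := hv
  have hp0 : 0 < p := by linarith
  have hUm := hU.aestronglyMeasurable hw
  have hp1 : 1 ≤ ENNReal.ofReal p := by simpa using hp.le
  -- Hölder pairs this with `v^{-1/p}` times the kernel, which the class `D_p` places in `L^{p'}`.
  have hvU : MemLp (fun y => v y ^ (1 / p) * U y) (ENNReal.ofReal p) volume := by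
    refine ⟨(hw.measurable.pow_const _).aestronglyMeasurable.mul hUm, ?_⟩
    have h2 := hU.2
    rw [eLpNorm_lt_top_iff_lintegral_rpow_enorm_lt_top (by simpa using hp0) ENNReal.ofReal_ne_top,
      ENNReal.toReal_ofReal hp0.le] at h2 ⊢
    rw [lintegral_withDensity_eq_lintegral_mul₀ hw.measurable.ennreal_ofReal.aemeasurable
      (hUm.enorm.pow_const p)] at h2
    refine lt_of_eq_of_lt (lintegral_congr fun y => ?_) h2
    have hvy := hw.pos y
    rw [Pi.mul_apply, enorm_mul, ENNReal.mul_rpow_of_nonneg _ _ hp0.le,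
      Real.enorm_of_nonneg (by positivity), ENNReal.ofReal_rpow_of_nonneg (by positivity) hp0.le,
      ← Real.rpow_mul hvy.le, one_div_mul_cancel hp0.ne', Real.rpow_one]
  have hint₀ : Integrable fun y => heatKernel n t₀ (x₀ - y) * U y := by
    have : ENNReal.HolderConjugate (ENNReal.ofReal p)
      (ENNReal.conjExponent (ENNReal.ofReal p)) := .conjExponent hp1
    refine (hvU.integrable_mul hmem).congr (ae_of_all _ fun y => ?_)
    have hvy := hw.pos y
    have e : v y ^ (1 / p) * v y ^ (-1 / p) = 1 := by
      rw [← Real.rpow_add hvy, ← add_div, add_neg_cancel, zero_div, Real.rpow_zero]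
    simp only [Pi.mul_apply]
    calc v y ^ (1 / p) * U y * (v y ^ (-1 / p) * heatKernel n t₀ (x₀ - y))
        = v y ^ (1 / p) * v y ^ (-1 / p) * (heatKernel n t₀ (x₀ - y) * U y) := by ring
      _ = _ := by rw [e, one_mul]
  -- Moving the centre from `x₀` to `x` uses `|x₀-y|² ≤ 2|x-y|² + 2|x-x₀|²`; the factor `2` is paid
  -- for by halving the time.
  refine ⟨t₀ / 2, by positivity, fun t ht x => ?_⟩
  have ht0 : 0 < t := ht.1
  set C := (4 * Real.pi * t) ^ (-(n : ℝ) / 2) *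
    (Real.exp (‖x - x₀‖ ^ 2 / (2 * t₀)) / (4 * Real.pi * t₀) ^ (-(n : ℝ) / 2)) with hC
  have hmK : Measurable fun y => heatKernel n t (x - y) :=
    (measurable_heatKernel n).comp (by fun_prop : Measurable fun y : Rn n => (t, x - y))
  refine Integrable.mono' (hint₀.norm.const_mul C)
    (hmK.aestronglyMeasurable.mul hUm) (ae_of_all _ fun y => ?_)
  rw [norm_mul, norm_mul, ← mul_assoc, Real.norm_of_nonneg (heatKernel_nonneg n ht0.le _),
    Real.norm_of_nonneg (heatKernel_nonneg n ht₀.le _)]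
  refine mul_le_mul_of_nonneg_right ?_ (norm_nonneg _)
  have hpos : 0 < (4 * Real.pi * t₀) ^ (-(n : ℝ) / 2) := by positivity
  calc heatKernel n t (x - y) = (4 * Real.pi * t) ^ (-(n : ℝ) / 2) *
        Real.exp (-‖x - y‖ ^ 2 / (4 * t)) := rfl
    _ ≤ (4 * Real.pi * t) ^ (-(n : ℝ) / 2) *
        Real.exp (‖x - x₀‖ ^ 2 / (2 * t₀) + -‖x₀ - y‖ ^ 2 / (4 * t₀)) := by
        gcongr
        have h1 : ‖x₀ - y‖ ≤ ‖x - y‖ + ‖x - x₀‖ := by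
          rw [show x₀ - y = (x - y) - (x - x₀) by abel]
          exact norm_sub_le _ _
        have h2 : ‖x₀ - y‖ ^ 2 ≤ 2 * ‖x - y‖ ^ 2 + 2 * ‖x - x₀‖ ^ 2 := by
          nlinarith [norm_nonneg (x₀ - y), sq_nonneg (‖x - y‖ - ‖x - x₀‖)]
        have h3 : ‖x - y‖ ^ 2 / (2 * t₀) ≤ ‖x - y‖ ^ 2 / (4 * t) := by
          refine div_le_div_of_nonneg_left (by positivity) (by positivity) ?_
          linarith [ht.2]
        have h4 : ‖x₀ - y‖ ^ 2 / (4 * t₀) ≤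
            ‖x - y‖ ^ 2 / (2 * t₀) + ‖x - x₀‖ ^ 2 / (2 * t₀) := by
          rw [← add_div, div_le_div_iff₀ (by positivity) (by positivity)]
          nlinarith
        rw [neg_div, neg_div]
        linarith
    _ = C * heatKernel n t₀ (x₀ - y) := by
        rw [Real.exp_add, hC, heatKernel]
        field_simp

end InitialData

/-! ### Proof of the theorem. -/

lemma enorm_powerNL {α : ℝ} (hα : 0 < α) (r : ℝ) : ‖powerNL α r‖ₑ = ‖r‖ₑ ^ α := by
  rw [Real.enorm_eq_ofReal_abs, Real.enorm_eq_ofReal_abs,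
    ENNReal.ofReal_rpow_of_nonneg (abs_nonneg _) hα.le, powerNL, abs_mul,
    abs_of_nonneg (Real.rpow_nonneg (abs_nonneg r) _)]
  congr 1
  nth_rw 2 [← Real.rpow_one |r|]
  rw [← Real.rpow_add' (abs_nonneg r) (by simpa using hα.ne'), sub_add_cancel]

lemma enorm_integral_heatKernel_powerNL_le {n : ℕ} {α : ℝ} (hα : 0 < α) (u : Rn n → ℝ → ℝ)
    (x : Rn n) (t : ℝ) :
    ‖∫ s in Ioo 0 t, ∫ y, heatKernel n (t - s) (x - y) * powerNL α (u y s)‖ₑ ≤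
      heatDuhamel (fun y s => ‖u y s‖ₑ ^ α) x t := by
  refine (enorm_integral_le_lintegral_enorm _).trans ?_
  refine setLIntegral_mono' measurableSet_Ioo fun s hs => ?_
  refine (enorm_integral_le_lintegral_enorm _).trans_eq (lintegral_congr fun y => ?_)
  rw [enorm_mul, enorm_powerNL hα, Real.enorm_of_nonneg (heatKernel_nonneg n
    (sub_nonneg.2 hs.2.le) _)]
  rfl

/-- Replacing `U` by a measurable representative changes no integral, so the measurability is
genuine, as the iteration requires. -/
lemma measurable_heatExtension {n : ℕ} {U : Rn n → ℝ} (hU : AEStronglyMeasurable U) :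
    Measurable (Function.uncurry (heatExtension U)) := by
  have e : Function.uncurry (heatExtension U) = fun z : Rn n × ℝ =>
      ∫ y, heatKernel n z.2 (z.1 - y) * hU.mk U y := by
    funext z
    refine integral_congr_ae (hU.ae_eq_mk.mono fun y hy => ?_)
    simp only [hy]
  rw [e]
  refine (StronglyMeasurable.integral_prod_right' (f := fun w : (Rn n × ℝ) × Rn n =>
    heatKernel n w.1.2 (w.1.1 - w.2) * hU.mk U w.2) ?_).measurable
  exact (((measurable_heatKernel n).comp (by fun_prop : Measurable fun w : (Rn n × ℝ) × Rn n =>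
    (w.1.2, w.1.1 - w.2))).mul
    (hU.stronglyMeasurable_mk.measurable.comp measurable_snd)).stronglyMeasurable

theorem mainTheorem8 (n : ℕ) (hn : 1 ≤ n) (α p q k T₀ : ℝ)
    (hα : 1 < α) (hk : 0 < k) (hT₀ : 0 < T₀)
    (hpq : α < min p q)
    (hkα : k * α / (q - α) < 1)
    (hβ : (n : ℝ) / 2 * ((α - 1) / p) * (q / (q - α)) < 1)
    (hexp : -1 < k + (q - α) *
      (1 - (n : ℝ) / 2 * ((α - 1) / p) * (q / (q - α)) - k * α / (q - α)))
    (hkq : k < q - 1)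
    (U v : Rn n → ℝ)
    (hh : MemX p q k T₀ (heatExtension U))
    (hv : WeightClassD p v) (hU : MemWeightedLp p v U) :
    (∃ T : ℝ, 0 < T ∧ T ≤ T₀ ∧ ∃ u : Rn n → ℝ → ℝ, MemX p q k T u ∧ IsMildSolution α T U u) ∧
    ∀ T : ℝ, 0 < T → ∀ u : Rn n → ℝ → ℝ, MemX p q k T u → IsMildSolution α T U u →
      ∀ᵐ x : Rn n, Tendsto (fun t => u x t) (𝓝[>] 0) (𝓝 (U x)) := by
  obtain ⟨hαp, hαq⟩ := lt_min_iff.1 hpq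
  have hα0 : 0 < α := by linarith
  have hp0 : 0 < p := by linarith
  have hq0 : 0 < q := by linarith
  obtain ⟨t₁, ht₁, hint⟩ := exists_integrable_heatKernel_mul (by linarith) hv hU
  have hUm := hU.aestronglyMeasurable hv.1
  refine ⟨?_, fun T hT u hu hmild => ?_⟩
  · have hhm := measurable_heatExtension hUm
    -- Absolute convergence of the heat extension is available only up to `t₁`.
    have hhfin : mixedNormPow p q k (min T₀ t₁) (fun x t => ‖heatExtension U x t‖ₑ) ≠ ⊤ := by
      have h2 := hh.2
      rw [memX_lintegral_eq hp0] at h2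
      exact ne_top_of_le_ne_top h2.ne (mixedNormPow_mono_set (min_le_left _ _))
    obtain ⟨T, hT, hTle, w, hwm, hwfin, hweq⟩ := exists_majorant hα hk hαp hαq hkα hβ hexp
      (lt_min hT₀ ht₁) (h := fun x t => ‖heatExtension U x t‖ₑ) hhm.enorm hhfin
    have hae := ae_heatDuhamel_lt_top_and_tendsto hα hk hαp hαq hkα hT hwm hwfin
    obtain ⟨u, hum, hule, hueq⟩ := exists_signed_solution hα hhm hwm hweq
      (hae.mono fun x hx => hx.1)
    refine ⟨T, hT, hTle.trans (min_le_left _ _), u, ⟨hum.aestronglyMeasurable, ?_⟩, ?_⟩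
    · rw [memX_lintegral_eq hp0]
      exact (mixedNormPow_mono hp0.le hq0.le fun x t _ => hule x t).trans_lt hwfin.lt_top
    · filter_upwards [hueq] with x hx t ht
      exact ⟨hint t ⟨ht.1, ht.2.le.trans (hTle.trans (min_le_right _ _))⟩ x, hx t ht⟩
  · obtain ⟨hum, hufin⟩ := hu
    rw [memX_lintegral_eq hp0] at hufin
    -- The estimates require a measurable function; neither the mixed norm nor the Duhamel integral
    -- sees the change of representative.
    set u' : Rn n → ℝ → ℝ≥0∞ := fun x t => ‖hum.mk _ (x, t)‖ₑ with hu'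
    have hu'm : Measurable (Function.uncurry u') := hum.stronglyMeasurable_mk.measurable.enorm
    have hae : ∀ᵐ z ∂((volume : Measure (Rn n)).prod (volume.restrict (Ioo 0 T))),
        ‖u z.1 z.2‖ₑ = u' z.1 z.2 := hum.ae_eq_mk.mono fun z hz =>
      congrArg enorm hz
    rw [mixedNormPow_congr_ae (F := fun x t => ‖u x t‖ₑ) hae] at hufin
    filter_upwards [hmild, ae_tendsto_heatExtension ht₁ (hint t₁ ⟨ht₁, le_rfl⟩),
      ae_heatDuhamel_lt_top_and_tendsto hα hk hαp hαq hkα hT hu'm hufin.ne] with x h1 h2 h3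
    have h4 : Tendsto (fun t => ∫ s in Ioo 0 t, ∫ y,
        heatKernel n (t - s) (x - y) * powerNL α (u y s)) (𝓝[>] 0) (𝓝 0) := by
      rw [tendsto_zero_iff_enorm_tendsto_zero]
      refine tendsto_of_tendsto_of_tendsto_of_le_of_le' tendsto_const_nhds h3.2
        (Eventually.of_forall fun _ => bot_le) ?_
      filter_upwards [Ioo_mem_nhdsGT hT] with t ht
      refine (enorm_integral_heatKernel_powerNL_le hα0 u x t).trans_eq ?_
      exact heatDuhamel_congr_ae ht.2.le (hae.mono fun z hz => by simp only [hz]) x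
    have h5 := h2.add h4
    rw [add_zero] at h5
    refine h5.congr' ?_
    filter_upwards [Ioo_mem_nhdsGT hT] with t ht
    exact ((h1 t ht).2.2).symm
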